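/- Let $\mathbb G$ be a step-2 Carnot group: the connected, simply connected Lie group whose finite-dimensional real Lie algebra is stratified as $\mathfrak g=\mathfrak v_1\oplus\mathfrak v_2$ with $[\mathfrak v_1,\mathfrak v_1]=\mathfrak v_2\neq\{0\}$ and $[\mathfrak v_1,\mathfrak v_2]=\{0\}$. In exponential coordinates its points are $p=U_1+U_2$ ($U_i\in\mathfrak v_i$), with product $U\cdot V=U+V+\tfrac12[U,V]$ and dilations $\delta_t(U_1+U_2)=tU_1+t^2U_2$. Let $\|\cdot\|:\mathbb G\to[0,\infty)$ be a homogeneous norm, i.e. it is continuous, $\|\delta_t p\|=t\|p\|$ for $t>0$, and $\|p\|=0$ if and only if $p=0$. Let $X_1,\dots,X_m$ be a basis of $\mathfrak v_1$, put $v=\exp X_1$, and let $\mathbb W$ be the vertical subgroup of the points whose $X_1$-coordinate vanishes. Write $x=(x_2,\dots,x_m)=\pi(w)\in\mathbb R^{m-1}$ for the horizontal coordinates of $w=(x,t,s)\in\mathbb W$, where $(t,s)$ are coordinates on $\mathfrak v_2$. For $\phi:\mathbb W\to\mathbb R$, the intrinsic graph is $\Sigma(\phi)=\{w\cdot\delta_{\phi(w)}(v):w\in\mathbb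 W\}$, and for $p\in\mathbb G$ let $\phi^{p}:\mathbb W\to\mathbb R$ be the function with $\Sigma(\phi^{p})=p\cdot\Sigma(\phi)$. A function $\psi:\mathbb W\to\mathbb R$ with $\psi(0)=0$ is intrinsically differentiable at $0$, with intrinsic differential $d\psi_0=T\in(\mathbb R^{m-1})^*$, if $|\psi(g)-T(\pi(g))|/\|g\|\to0$ as $g\to0$. A function $\phi$ is intrinsically differentiable at $w\in\mathbb W$ if $\psi=\phi^{(p^{-1})}$, with $p=w\cdot\delta_{\phi(w)}(v)$, is intrinsically differentiable at $0$; then $d\phi_w:=d\psi_0$, and the intrinsic gradient $\nabla^\phi\phi(w)\in\mathbb R^{m-1}$ is the vector with $d\phi_w(x)=\nabla^\phi\phi(w)\cdot x$ for all $x$. For $\alpha\in[0,1]$, $\phi\in C^{1,\alpha}(\mathbb W)$ with Hölder constant $H>0$ means that $\phi$ is intrinsically differentiable at every point of $\mathbb W$, that $w\mapsto d\phi_w$ is continuous, and that $$\|d\phi^{(p^{-1})}_w-d\phi^{(p^{-1})}_0\|_{\mathrm{op}}\le H\|w\|^\alpha\qquad\text{for all }p\in\Sigma(\phi),\ w\in\mathbb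 W .$$ **Proposition.** For all $L\ge 0$ and $H>0$ there is a constant $C>0$, depending only on $L$, $H$ and the fixed data ($\mathbb G$, $\|\cdot\|$ and $X_1,\dots,X_m$), such that the following holds. Let $\alpha\in[0,1]$ and let $\phi\in C^{1,\alpha}(\mathbb W)$ with Hölder constant $H$ and $\|\nabla^\phi\phi\|_\infty\le L$. Then for every $w_0\in\mathbb W$, with $p_0=w_0\cdot\delta_{\phi(w_0)}(v)\in\Sigma(\phi)$, $$\bigl|\phi^{(p_0^{-1})}(x,t,s)-\nabla^\phi\phi(w_0)\cdot x\bigr|\le C\max\bigl\{\|(x,t,s)\|^{1+\alpha},\ \|(x,t,s)\|^{1+\alpha/2}\bigr\}\qquad\text{for all }(x,t,s)\in\mathbb W .$$ -/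

import Mathlib

namespace Step2Carnot

noncomputable section

open Filter
open scoped Topology

universe u

/-- A step-two stratification `𝔤 = V₁ ⊕ V₂` of a real Lie algebra:
`[V₁, V₁] = V₂ ≠ 0` and `[V₁, V₂] = 0`. -/
structure Stratification (𝔤 : Type u) [LieRing 𝔤] [LieAlgebra ℝ 𝔤] where
  V₁ : Submodule ℝ 𝔤
  V₂ : Submodule ℝ 𝔤
  isCompl : IsCompl V₁ V₂
  span_lie : Submodule.span ℝ {z : 𝔤 | ∃ x ∈ V₁, ∃ y ∈ V₁, ⁅x, y⁆ = z} = V₂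
  lie_eq_zero : ∀ x ∈ V₁, ∀ z ∈ V₂, ⁅x, z⁆ = 0
  V₂_ne_bot : V₂ ≠ ⊥

/-- The points of the connected, simply connected Lie group with Lie algebra `𝔤`, in exponential
coordinates: the element `⟨U⟩` stands for `exp U`. -/
@[ext]
structure CarnotGroup {𝔤 : Type u} [LieRing 𝔤] [LieAlgebra ℝ 𝔤] (S : Stratification 𝔤) where
  log : 𝔤

section Algebra

variable {𝔤 : Type u} [LieRing 𝔤] [LieAlgebra ℝ 𝔤]

/-- The projection of the Lie algebra onto its horizontal layer, along the second layer. -/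
def Stratification.horiz (S : Stratification 𝔤) : 𝔤 →ₗ[ℝ] S.V₁ :=
  S.V₁.projectionOnto S.V₂ S.isCompl

/-- The projection of the Lie algebra onto its second layer, along the horizontal layer. -/
def Stratification.vert (S : Stratification 𝔤) : 𝔤 →ₗ[ℝ] S.V₂ :=
  S.V₂.projectionOnto S.V₁ S.isCompl.symm

theorem Stratification.horiz_add_vert (S : Stratification 𝔤) (U : 𝔤) :
    (S.horiz U : 𝔤) + (S.vert U : 𝔤) = U :=
  Submodule.projection_add_projection_eq_self S.isCompl U

theorem Stratification.lie_V₂ (S : Stratification 𝔤) (U z : 𝔤) (hz : z ∈ S.V₂) : ⁅U, z⁆ = 0 := by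
  have h2 : ∀ y ∈ S.V₂, ⁅y, z⁆ = 0 := by
    intro y hy
    rw [← S.span_lie] at hy
    induction hy using Submodule.span_induction with
    | mem y hy =>
      obtain ⟨a, ha, b, hb, rfl⟩ := hy
      rw [lie_lie, S.lie_eq_zero a ha z hz, S.lie_eq_zero b hb z hz]
      simp
    | zero => simp
    | add a b _ _ ha hb => simp [ha, hb]
    | smul c a _ ha => simp [ha]
  rw [← S.horiz_add_vert U, add_lie, S.lie_eq_zero _ (S.horiz U).2 z hz,
    h2 _ (S.vert U).2, add_zero]

theorem Stratification.lie_mem (S : Stratification 𝔤) (U V : 𝔤) : ⁅U, V⁆ ∈ S.V₂ := by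
  rw [← S.horiz_add_vert V, lie_add, S.lie_V₂ U _ (S.vert V).2, add_zero,
    ← S.horiz_add_vert U, add_lie, ← lie_skew (S.vert U : 𝔤), S.lie_V₂ _ _ (S.vert U).2, neg_zero,
    add_zero]
  rw [← S.span_lie]
  exact Submodule.subset_span ⟨_, (S.horiz U).2, _, (S.horiz V).2, rfl⟩

theorem Stratification.lie_lie_left (S : Stratification 𝔤) (U V W : 𝔤) : ⁅⁅U, V⁆, W⁆ = 0 := by
  rw [← lie_skew, S.lie_V₂ _ _ (S.lie_mem U V), neg_zero]

theorem Stratification.lie_lie_right (S : Stratification 𝔤) (U V W : 𝔤) : ⁅W, ⁅U, V⁆⁆ = 0 :=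
  S.lie_V₂ _ _ (S.lie_mem U V)

/-- The group law given by the Baker-Campbell-Hausdorff formula,
`exp U * exp V = exp (U + V + ½[U, V])`. -/
instance (S : Stratification 𝔤) : Group (CarnotGroup S) where
  mul p q := ⟨p.log + q.log + (1 / 2 : ℝ) • ⁅p.log, q.log⁆⟩
  one := ⟨0⟩
  inv p := ⟨-p.log⟩
  mul_assoc p q r := by
    change CarnotGroup.mk _ = CarnotGroup.mk _
    congr 1
    change (p.log + q.log + (1 / 2 : ℝ) • ⁅p.log, q.log⁆) + r.log + (1 / 2 : ℝ) •
        ⁅p.log + q.log + (1 / 2 : ℝ) • ⁅p.log, q.log⁆, r.log⁆ =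
      p.log + (q.log + r.log + (1 / 2 : ℝ) • ⁅q.log, r.log⁆) + (1 / 2 : ℝ) •
        ⁅p.log, q.log + r.log + (1 / 2 : ℝ) • ⁅q.log, r.log⁆⁆
    simp only [add_lie, lie_add, smul_lie, lie_smul, S.lie_lie_left, S.lie_lie_right, smul_zero,
      add_zero, smul_add]
    abel
  one_mul p := by
    change CarnotGroup.mk _ = _
    ext
    change (0 : 𝔤) + p.log + (1 / 2 : ℝ) • ⁅(0 : 𝔤), p.log⁆ = p.log
    simp
  mul_one p := by
    change CarnotGroup.mk _ = _
    ext
    change p.log + (0 : 𝔤) + (1 / 2 : ℝ) • ⁅p.log, (0 : 𝔤)⁆ = p.log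
    simp
  inv_mul_cancel p := by
    change CarnotGroup.mk _ = CarnotGroup.mk _
    congr 1
    change -p.log + p.log + (1 / 2 : ℝ) • ⁅-p.log, p.log⁆ = 0
    simp

variable {S : Stratification 𝔤}

theorem log_mul (p q : CarnotGroup S) :
    (p * q).log = p.log + q.log + (1 / 2 : ℝ) • ⁅p.log, q.log⁆ := rfl

theorem log_one : (1 : CarnotGroup S).log = 0 := rfl

theorem log_inv (p : CarnotGroup S) : (p⁻¹).log = -p.log := rfl

/-- The dilations `δ_t`, equal to `t` on the first layer and to `t ^ 2` on the second layer. -/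
def dil (t : ℝ) (p : CarnotGroup S) : CarnotGroup S :=
  ⟨t • (S.horiz p.log : 𝔤) + t ^ 2 • (S.vert p.log : 𝔤)⟩

/-- The group has the topology of the (finite-dimensional) vector space `𝔤`. -/
instance [TopologicalSpace 𝔤] : TopologicalSpace (CarnotGroup S) :=
  TopologicalSpace.induced CarnotGroup.log inferInstance

/-- A homogeneous norm: continuous, nonnegative, `1`-homogeneous with respect to positive
dilations, and vanishing exactly at the identity. -/
structure IsHomogeneousNorm [TopologicalSpace 𝔤] (N : CarnotGroup S → ℝ) : Prop where
  continuous : Continuous N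
  nonneg : ∀ p, 0 ≤ N p
  dil : ∀ t : ℝ, 0 < t → ∀ p, N (dil t p) = t * N p
  eq_zero_iff : ∀ p, N p = 0 ↔ p = 1

/-!
In what follows a basis `X = (X 0, …, X n)` of the horizontal layer is fixed. The vector `X 0` is
the direction along which graphs are taken.
-/

variable {n : ℕ} (X : Module.Basis (Fin (n + 1)) ℝ S.V₁)

/-- The horizontal coordinate `x_i` of a point. -/
def coord (i : Fin (n + 1)) (p : CarnotGroup S) : ℝ := X.repr (S.horiz p.log) i

theorem coord_mul (i : Fin (n + 1)) (p q : CarnotGroup S) :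
    coord X i (p * q) = coord X i p + coord X i q := by
  have h : S.horiz ⁅p.log, q.log⁆ = 0 :=
    (Submodule.projectionOnto_apply_eq_zero_iff S.isCompl).2 (S.lie_mem _ _)
  simp [coord, log_mul, h]

theorem coord_one (i : Fin (n + 1)) : coord X i (1 : CarnotGroup S) = 0 := by
  simp [coord, log_one]

theorem coord_inv (i : Fin (n + 1)) (p : CarnotGroup S) : coord X i p⁻¹ = -coord X i p := by
  simp [coord, log_inv]

/-- The vertical subgroup `𝕎 = {x_0 = 0}`, of codimension one. -/
def W : Subgroup (CarnotGroup S) where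
  carrier := {p | coord X 0 p = 0}
  mul_mem' := by
    intro a b ha hb
    simp only [Set.mem_ofPred_eq] at *
    rw [coord_mul, ha, hb, add_zero]
  one_mem' := coord_one X 0
  inv_mem' := by
    intro a ha
    simp only [Set.mem_ofPred_eq] at *
    rw [coord_inv, ha, neg_zero]

/-- The horizontal coordinates `(x_1, …, x_n)` of a point of `𝕎`. -/
def hor (w : W X) : EuclideanSpace ℝ (Fin n) :=
  WithLp.toLp 2 (fun i => coord X i.succ (w : CarnotGroup S))

/-- The horizontal vector `v = exp (X 0)`. -/
def dir : CarnotGroup S := ⟨(X 0 : 𝔤)⟩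

theorem coord_zero_dil_dir (t : ℝ) : coord X 0 (dil t (dir X)) = t := by
  have h1 : S.horiz (X 0 : 𝔤) = X 0 := Submodule.projectionOnto_apply_left S.isCompl _
  have h2 : S.vert (X 0 : 𝔤) = 0 := Submodule.projectionOnto_apply_right S.isCompl.symm _
  simp [coord, dil, dir, h1, h2]

/-- The intrinsic graph map `Σ(φ)(w) = w · δ_{φ(w)}(v)` of `φ : 𝕎 → ℝ`. The intrinsic graph of `φ`
is the range of this map. -/
def graph (φ : W X → ℝ) (w : W X) : CarnotGroup S := (w : CarnotGroup S) * dil (φ w) (dir X)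

/-- The projection `p ↦ p_𝕎`, where `p = p_𝕎 · p_𝕍` with `p_𝕎 ∈ 𝕎` and
`p_𝕍 = δ_{x_0(p)}(v)`. -/
def projW (p : CarnotGroup S) : W X :=
  ⟨p * (dil (coord X 0 p) (dir X))⁻¹, by
    change coord X 0 _ = 0
    rw [coord_mul, coord_inv, coord_zero_dil_dir, add_neg_cancel]⟩

/-- The function `φ^p`, whose intrinsic graph is the left translate by `p` of that of `φ`
(see `range_graph_translate` and `translate_unique`). -/
def translate (φ : W X → ℝ) (p : CarnotGroup S) (w : W X) : ℝ :=
  φ (projW X (p⁻¹ * (w : CarnotGroup S))) - coord X 0 (p⁻¹ * (w : CarnotGroup S))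

variable {X}

theorem dil_add_dir (s t : ℝ) : dil (s + t) (dir X) = dil s (dir X) * dil t (dir X) := by
  have h2 : S.vert (X 0 : 𝔤) = 0 := Submodule.projectionOnto_apply_right S.isCompl.symm _
  ext
  simp [log_mul, dil, dir, h2, add_smul]

theorem projW_mul_dil (w : W X) (t : ℝ) : projW X ((w : CarnotGroup S) * dil t (dir X)) = w := by
  have hw : coord X 0 (w : CarnotGroup S) = 0 := w.2
  ext1
  simp [projW, coord_mul, hw, coord_zero_dil_dir]

theorem mem_range_graph_iff (φ : W X → ℝ) (p : CarnotGroup S) :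
    p ∈ Set.range (graph X φ) ↔ φ (projW X p) = coord X 0 p := by
  constructor
  · rintro ⟨w, rfl⟩
    have hw : coord X 0 (w : CarnotGroup S) = 0 := w.2
    simp [graph, projW_mul_dil, coord_mul, hw, coord_zero_dil_dir]
  · intro h
    refine ⟨projW X p, ?_⟩
    rw [graph, h]
    simp [projW]

/-- The graph of `φ^p` is `p · Σ(φ)`. -/
theorem range_graph_translate (φ : W X → ℝ) (p : CarnotGroup S) :
    Set.range (graph X (translate X φ p)) = (fun q => p * q) '' Set.range (graph X φ) := by
  ext q
  have hq : q = (projW X q : CarnotGroup S) * dil (coord X 0 q) (dir X) := by simp [projW]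
  have h3 : projW X (p⁻¹ * q) = projW X (p⁻¹ * (projW X q : CarnotGroup S)) := by
    set r : CarnotGroup S := p⁻¹ * (projW X q : CarnotGroup S) with hr
    have hr' : r = (projW X r : CarnotGroup S) * dil (coord X 0 r) (dir X) := by simp [projW]
    have : p⁻¹ * q = (projW X r : CarnotGroup S) * dil (coord X 0 r + coord X 0 q) (dir X) := by
      rw [dil_add_dir, ← mul_assoc, ← hr', hr, mul_assoc, ← hq]
    rw [this, projW_mul_dil]
  have hw : coord X 0 (projW X q : CarnotGroup S) = 0 := (projW X q).2
  have : q ∈ (fun q => p * q) '' Set.range (graph X φ) ↔ p⁻¹ * q ∈ Set.range (graph X φ) := by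
    constructor
    · rintro ⟨r, hr, rfl⟩
      simpa using hr
    · intro h
      exact ⟨_, h, by simp⟩
  rw [this, mem_range_graph_iff, mem_range_graph_iff, h3, translate, coord_mul, coord_mul, hw,
    add_zero, sub_eq_iff_eq_add, add_comm (coord X 0 q)]

/-- A function on `𝕎` is determined by its intrinsic graph, so that `φ^p` is the only function
whose graph is `p · Σ(φ)`. -/
theorem translate_unique (φ ψ : W X → ℝ) (p : CarnotGroup S)
    (h : Set.range (graph X ψ) = (fun q => p * q) '' Set.range (graph X φ)) :
    ψ = translate X φ p := by
  rw [← range_graph_translate] at h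
  ext w
  have hw : coord X 0 (w : CarnotGroup S) = 0 := w.2
  have h1 : graph X ψ w ∈ Set.range (graph X (translate X φ p)) := h ▸ ⟨w, rfl⟩
  rw [mem_range_graph_iff] at h1
  simp only [graph, projW_mul_dil, coord_mul, hw, coord_zero_dil_dir, zero_add] at h1
  exact h1.symm

end Algebra

section Calculus

variable {𝔤 : Type u} [LieRing 𝔤] [LieAlgebra ℝ 𝔤] [TopologicalSpace 𝔤]
  {S : Stratification 𝔤} {n : ℕ} {X : Module.Basis (Fin (n + 1)) ℝ S.V₁}

/-- `ψ` with `ψ(0) = 0` is intrinsically differentiable at the identity, with the linear functional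
`T` as its differential: `|ψ(g) - T(π(g))| / ‖g‖ → 0` as `g → 0`, `g ≠ 0`. -/
def HasIntrinsicDiffZero (N : CarnotGroup S → ℝ) (ψ : W X → ℝ)
    (T : StrongDual ℝ (EuclideanSpace ℝ (Fin n))) : Prop :=
  ψ 1 = 0 ∧ Tendsto (fun g : W X => |ψ g - T (hor X g)| / N (g : CarnotGroup S)) (𝓝[≠] 1) (𝓝 0)

/-- The intrinsic differential at the identity is unique. -/
theorem HasIntrinsicDiffZero.unique [ContinuousAdd 𝔤] [ContinuousSMul ℝ 𝔤] {N : CarnotGroup S → ℝ}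
    (hN : IsHomogeneousNorm N) {ψ : W X → ℝ} {T₁ T₂ : StrongDual ℝ (EuclideanSpace ℝ (Fin n))}
    (h₁ : HasIntrinsicDiffZero N ψ T₁) (h₂ : HasIntrinsicDiffZero N ψ T₂) : T₁ = T₂ := by
  ext x
  by_cases hx : x = 0
  · simp [hx]
  let u : S.V₁ := ∑ i : Fin n, x i • X i.succ
  have hu : ∀ j, X.repr u j = ∑ i : Fin n, x i * (if i.succ = j then 1 else 0) := by
    intro j
    simp [u, Finsupp.single_apply]
  have hc : ∀ (t : ℝ) j, coord X j (⟨t • (u : 𝔤)⟩ : CarnotGroup S) = t * X.repr u j := by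
    intro t j
    have h1 : S.horiz (u : 𝔤) = u := Submodule.projectionOnto_apply_left S.isCompl _
    simp [coord, h1]
  let g : ℝ → W X := fun t => ⟨⟨t • (u : 𝔤)⟩, by
    change coord X 0 _ = 0
    rw [hc, hu]
    simp [Fin.succ_ne_zero]⟩
  have hg : ∀ t, hor X (g t) = t • x := by
    intro t
    ext i
    simp [hor, g, hc, hu]
  have hd : ∀ t : ℝ, (g t : CarnotGroup S) = dil t (g 1 : CarnotGroup S) := by
    intro t
    have h1 : S.horiz (u : 𝔤) = u := Submodule.projectionOnto_apply_left S.isCompl _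
    have h2 : S.vert (u : 𝔤) = 0 := Submodule.projectionOnto_apply_right S.isCompl.symm _
    ext
    simp [g, dil, h1, h2]
  have hne : ∀ t : ℝ, 0 < t → g t ≠ 1 := by
    intro t ht h
    have := hg t
    rw [h] at this
    have h0 : hor X (1 : W X) = 0 := by
      ext i
      simp [hor, coord_one]
    rw [h0] at this
    exact (smul_ne_zero ht.ne' hx) this.symm
  have hN1 : 0 < N (g 1 : CarnotGroup S) := by
    refine lt_of_le_of_ne (hN.nonneg _) fun h => hne 1 one_pos ?_
    ext1
    exact (hN.eq_zero_iff _).1 h.symm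
  have hcont : Continuous g := by
    refine Continuous.subtype_mk (continuous_induced_rng.2 ?_) _
    exact continuous_id.smul continuous_const
  have hg0 : g 0 = 1 := by
    ext
    simp [g, log_one]
  have hlim : Tendsto g (𝓝[>] 0) (𝓝[≠] 1) := by
    refine tendsto_nhdsWithin_iff.2 ⟨?_, ?_⟩
    · have := hcont.tendsto 0
      rw [hg0] at this
      exact this.mono_left nhdsWithin_le_nhds
    · filter_upwards [self_mem_nhdsWithin] with t ht using hne t ht
  have hs := (h₁.2.comp hlim).add (h₂.2.comp hlim)
  have hle : |T₁ x - T₂ x| / N (g 1 : CarnotGroup S) ≤ 0 + 0 := by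
    refine ge_of_tendsto hs ?_
    filter_upwards [self_mem_nhdsWithin] with t ht
    have ht : 0 < t := ht
    simp only [Function.comp_apply]
    rw [hd t, hN.dil t ht, hg, ← add_div, map_smul, map_smul, smul_eq_mul, smul_eq_mul,
      div_le_div_iff₀ hN1 (by positivity)]
    have h3 : t * |T₁ x - T₂ x| ≤ |ψ (g t) - t * T₁ x| + |ψ (g t) - t * T₂ x| := by
      have : t * |T₁ x - T₂ x| = |(ψ (g t) - t * T₂ x) - (ψ (g t) - t * T₁ x)| := by
        rw [← abs_of_pos ht, ← abs_mul, abs_of_pos ht]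
        congr 1
        ring
      rw [this, add_comm]
      exact abs_sub _ _
    nlinarith
  rw [add_zero, div_le_iff₀ hN1, zero_mul] at hle
  exact sub_eq_zero.1 (abs_nonpos_iff.1 hle)

open Classical in
/-- The intrinsic differential `dψ_0` at the identity (zero if `ψ` is not intrinsically
differentiable there). -/
def intrinsicDiffZero (N : CarnotGroup S → ℝ) (ψ : W X → ℝ) :
    StrongDual ℝ (EuclideanSpace ℝ (Fin n)) :=
  if h : ∃ T, HasIntrinsicDiffZero N ψ T then h.choose else 0

/-- `φ` is intrinsically differentiable at `w`: for `p = w · δ_{φ(w)}(v)`, the function `φ^{(p⁻¹)}`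
is intrinsically differentiable at the identity. -/
def IntrinsicDifferentiableAt (N : CarnotGroup S → ℝ) (φ : W X → ℝ) (w : W X) : Prop :=
  ∃ T, HasIntrinsicDiffZero N (translate X φ (graph X φ w)⁻¹) T

/-- The intrinsic differential `dφ_w`. -/
def intrinsicDiff (N : CarnotGroup S → ℝ) (φ : W X → ℝ) (w : W X) :
    StrongDual ℝ (EuclideanSpace ℝ (Fin n)) :=
  intrinsicDiffZero N (translate X φ (graph X φ w)⁻¹)

/-- The intrinsic gradient `∇^φ φ` at the point of the graph over `w`: the vector that represents
the differential at the identity of `φ^{(p⁻¹)}`, `p = w · δ_{φ(w)}(v)`. -/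
def intrinsicGrad (N : CarnotGroup S → ℝ) (φ : W X → ℝ) (w : W X) : EuclideanSpace ℝ (Fin n) :=
  (InnerProductSpace.toDual ℝ (EuclideanSpace ℝ (Fin n))).symm
    (intrinsicDiffZero N (translate X φ (graph X φ w)⁻¹))

/-- Intrinsic `C¹(𝕎)` functions. -/
structure IsIntrinsicC1 (N : CarnotGroup S → ℝ) (φ : W X → ℝ) : Prop where
  differentiable : ∀ w, IntrinsicDifferentiableAt N φ w
  continuous : Continuous (intrinsicDiff N φ)

/-- Intrinsic `C^{1,α}(𝕎)` functions with Hölder constant `H`: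
`‖dφ^{(p⁻¹)}_w - dφ^{(p⁻¹)}_0‖ ≤ H ‖w‖^α` for all `p ∈ Σ(φ)` and `w ∈ 𝕎`.
The class `C^{1,α}(𝕎)` is the union of these classes over `H > 0`. -/
structure IsIntrinsicC1Alpha (N : CarnotGroup S → ℝ) (α H : ℝ) (φ : W X → ℝ) : Prop where
  isC1 : IsIntrinsicC1 N φ
  holder : ∀ p ∈ Set.range (graph X φ), ∀ w : W X,
    ‖intrinsicDiff N (translate X φ p⁻¹) w - intrinsicDiff N (translate X φ p⁻¹) 1‖ ≤
      H * N (w : CarnotGroup S) ^ α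

end Calculus

end

end Step2Carnot

/-! In coordinates `E × V` on the vertical subgroup, translation by a graph point over `p` becomes
`move`, a translation sheared vertically by `F p • lam`, where `lam y = [X 0, y]`. The hypotheses
are invariant under it, so every estimate may be made at the origin with `F 0 = 0`. Along an
integral curve of the nonlinear field "horizontal direction `e` plus `F` times `lam e`", the
function `F` has right derivative `D e`. Since `D` is Hölder, following such a curve for time `r`
changes `F` by `r * D 0 e` up to O(r^(1+α)). The endpoint has the desired horizontal coordinate and
misses the vertical one by O(r²), so it remains to bound the vertical oscillation of `F`.

The second layer is spanned by brackets [a, b] of horizontal directions of the vertical subgroup and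
by the vectors [X 0, y]. For [a, b], follow `a, b, -a, -b`: the first-order terms cancel, and the
loop ends at r²[a, b] up to some [X 0, l] with `l` = O(r²) (`exists_loop`). For [X 0, y], compare
two integral curves in the same direction, started at gap s along `lam e`
(`IsHolderGraph.sub_vertical_le`). The gap h satisfies |h''| ≲ |h|^(α/2), and h = 0 forces h' = 0
because `F` is single-valued. Hence h cannot close too fast: h'(0)² ≲ s^(1+α/2), that is, |h'(0)| ≲
(√s)^(1+α/2). This is the source of the second exponent.

The field is only continuous, so its curves come from Peano's theorem; uniqueness is never needed.
-/

namespace Step2Carnot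

noncomputable section

open Filter Set
open scoped Topology

/-! ### Peano existence for bounded continuous scalar equations -/

section Peano

/-- The nodes of the Euler scheme with step `h` for `y' = f t y`, `y 0 = 0`. -/
def eulerNode (f : ℝ → ℝ → ℝ) (h : ℝ) : ℕ → ℝ
  | 0 => 0
  | k + 1 => eulerNode f h k + h * f (k * h) (eulerNode f h k)

/-- Each Euler increment differs from `h * c` by at most `h * ε`. With `c = 0` this gives the
Lipschitz bound; with `c` the limiting slope it gives the derivative. -/
theorem abs_eulerNode_sub_le {f : ℝ → ℝ → ℝ} {h c ε : ℝ} (hh : 0 ≤ h) {j k : ℕ} (hjk : j ≤ k)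
    (hc : ∀ i, j ≤ i → i < k → |f (i * h) (eulerNode f h i) - c| ≤ ε) :
    |eulerNode f h k - eulerNode f h j - (k - j) * h * c| ≤ (k - j) * h * ε := by
  induction k, hjk using Nat.le_induction with
  | base => simp
  | succ k hjk ih =>
    have h1 := ih fun i hi hik => hc i hi (hik.trans (Nat.lt_succ_self k))
    have h2 := hc k hjk (Nat.lt_succ_self k)
    have h3 : eulerNode f h (k + 1) - eulerNode f h j - ((k + 1 : ℕ) - j) * h * c =
        (eulerNode f h k - eulerNode f h j - (k - j) * h * c) +
          h * (f (k * h) (eulerNode f h k) - c) := by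
      simp only [eulerNode]; push_cast; ring
    rw [h3]
    refine (abs_add_le _ _).trans ?_
    rw [abs_mul, abs_of_nonneg hh]
    have := mul_le_mul_of_nonneg_left h2 hh
    push_cast
    linarith

/-- The number of Euler steps of length `1 / (n + 1)` up to time `t`. -/
def eulerIndex (n : ℕ) (t : ℝ) : ℕ := ⌊t * (n + 1)⌋₊

theorem eulerIndex_mono (n : ℕ) : Monotone (eulerIndex n) := fun s t hst =>
  Nat.floor_mono (mul_le_mul_of_nonneg_right hst (by positivity))

theorem eulerIndex_mul_le (n : ℕ) {t : ℝ} (ht : 0 ≤ t) :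
    (eulerIndex n t : ℝ) * (1 / ((n : ℝ) + 1)) ≤ t := by
  rw [mul_one_div, div_le_iff₀ (by positivity)]
  exact Nat.floor_le (by positivity)

theorem lt_eulerIndex_mul (n : ℕ) (t : ℝ) :
    t - 1 / ((n : ℝ) + 1) < (eulerIndex n t : ℝ) * (1 / ((n : ℝ) + 1)) := by
  rw [sub_lt_iff_lt_add, ← add_one_mul, mul_one_div, lt_div_iff₀ (by positivity)]
  exact Nat.lt_floor_add_one _

theorem eulerIndex_of_nonpos (n : ℕ) {t : ℝ} (ht : t ≤ 0) : eulerIndex n t = 0 :=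
  Nat.floor_of_nonpos (mul_nonpos_of_nonpos_of_nonneg ht (by positivity))

/-- Piecewise constant Euler approximations. -/
def eulerApprox (f : ℝ → ℝ → ℝ) (n : ℕ) (t : ℝ) : ℝ :=
  eulerNode f (1 / ((n : ℝ) + 1)) (eulerIndex n t)

theorem abs_eulerApprox_sub_le {f : ℝ → ℝ → ℝ} {B : ℝ} (hB : ∀ t y, |f t y| ≤ B) (n : ℕ)
    {s t : ℝ} (hst : s ≤ t) :
    |eulerApprox f n t - eulerApprox f n s| ≤ B * (t - s + 1 / ((n : ℝ) + 1)) := by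
  have hB0 : 0 ≤ B := (abs_nonneg _).trans (hB 0 0)
  have hh : (0 : ℝ) ≤ 1 / ((n : ℝ) + 1) := by positivity
  have h1 := abs_eulerNode_sub_le (f := f) (c := 0) (ε := B) hh (eulerIndex_mono n hst)
    fun i _ _ => by simpa using hB _ _
  rw [mul_zero, sub_zero] at h1
  refine h1.trans ?_
  rw [mul_comm _ B]
  refine mul_le_mul_of_nonneg_left ?_ hB0
  rcases le_total t 0 with ht | ht
  · rw [eulerIndex_of_nonpos n ht, eulerIndex_of_nonpos n (hst.trans ht)]
    simp only [sub_self, zero_mul]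
    linarith
  · have h2 := eulerIndex_mul_le n ht
    have h3 := lt_eulerIndex_mul n s
    linarith

/-- Peano's theorem for a bounded scalar equation. -/
theorem exists_forall_hasDerivWithinAt_Ici {f : ℝ → ℝ → ℝ} (hf : Continuous (Function.uncurry f))
    {B : ℝ} (hB : ∀ t y, |f t y| ≤ B) :
    ∃ ζ : ℝ → ℝ, ζ 0 = 0 ∧ Continuous ζ ∧
      ∀ t, 0 ≤ t → HasDerivWithinAt ζ (f t (ζ t)) (Ici t) t := by
  have hB0 : 0 ≤ B := (abs_nonneg _).trans (hB 0 0)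
  -- Limits along a free ultrafilter replace the Arzelà–Ascoli extraction: bounded values converge
  -- at every `t` at once.
  let U : Ultrafilter ℕ := hyperfilter ℕ
  have hU : (U : Filter ℕ) ≤ atTop := Nat.hyperfilter_le_atTop
  have hstep : Tendsto (fun n : ℕ => 1 / ((n : ℝ) + 1)) U (𝓝 0) :=
    tendsto_one_div_add_atTop_nhds_zero_nat.mono_left hU
  have h0 : ∀ n, eulerApprox f n 0 = 0 := fun n => by
    simp [eulerApprox, eulerIndex_of_nonpos, eulerNode]
  have hlim : ∀ t, ∃ y, Tendsto (fun n => eulerApprox f n t) U (𝓝 y) := by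
    intro t
    have hK : IsCompact (Icc (-(B * (|t| + 1))) (B * (|t| + 1))) := isCompact_Icc
    obtain ⟨y, -, hy⟩ := hK.ultrafilter_le_nhds' (U.map fun n => eulerApprox f n t) (by
      refine Ultrafilter.mem_map.2 (Filter.mem_of_superset Filter.univ_mem fun n _ => ?_)
      refine abs_le.1 ?_
      have hn : 1 / ((n : ℝ) + 1) ≤ 1 := by
        rw [div_le_one (by positivity)]
        linarith [n.cast_nonneg (α := ℝ)]
      rcases le_total 0 t with ht | ht
      · have := abs_eulerApprox_sub_le hB n ht
        rw [h0, sub_zero] at this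
        refine this.trans (mul_le_mul_of_nonneg_left ?_ hB0)
        rw [abs_of_nonneg ht]; linarith
      · have := abs_eulerApprox_sub_le hB n ht
        rw [h0, zero_sub, abs_neg] at this
        refine this.trans (mul_le_mul_of_nonneg_left ?_ hB0)
        rw [abs_of_nonpos ht]; linarith)
    exact ⟨y, hy⟩
  choose ζ hζ using hlim
  have hLip : ∀ s t, s ≤ t → |ζ t - ζ s| ≤ B * (t - s) := by
    intro s t hst
    have h1 : Tendsto (fun n : ℕ => B * (t - s + 1 / ((n : ℝ) + 1))) U (𝓝 (B * (t - s + 0))) :=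
      (hstep.const_add _).const_mul _
    rw [add_zero] at h1
    exact le_of_tendsto_of_tendsto ((hζ t).sub (hζ s)).abs h1
      (Eventually.of_forall fun n => abs_eulerApprox_sub_le hB n hst)
  refine ⟨ζ, ?_, ?_, ?_⟩
  · refine tendsto_nhds_unique (hζ 0) ?_
    simp only [h0]
    exact tendsto_const_nhds
  · have : LipschitzWith ⟨B, hB0⟩ ζ := by
      refine LipschitzWith.of_dist_le_mul fun x y => ?_
      rw [Real.dist_eq, Real.dist_eq]
      rcases le_total x y with h | h
      · rw [abs_sub_comm, abs_sub_comm x y, abs_of_nonneg (sub_nonneg.2 h)]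
        exact hLip x y h
      · rw [abs_of_nonneg (sub_nonneg.2 h)]
        exact hLip y x h
    exact this.continuous
  · intro t ht
    rw [hasDerivWithinAt_iff_isLittleO, Asymptotics.isLittleO_iff]
    intro ε hε
    obtain ⟨δ, hδ, hcont⟩ := Metric.continuousAt_iff.1 (hf.continuousAt (x := (t, ζ t))) ε hε
    -- If `s - t` and the step are both below this bound, the nodes between `t` and `s` stay within
    -- `δ` of `(t, ζ t)`: two contributions below `δ / 4` from the motion and one from the
    -- convergence at `t`.
    have hpos : 0 < δ / (4 * (B + 1)) := by positivity
    have hev : ∀ᶠ s in 𝓝[Ici t] t, s ∈ Ico t (t + δ / (4 * (B + 1))) :=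
      Ico_mem_nhdsGE (by linarith)
    filter_upwards [hev] with s hs
    have hs0 : 0 ≤ s - t := sub_nonneg.2 hs.1
    have hsd : (s - t) * (4 * (B + 1)) < δ := by
      rw [← lt_div_iff₀ (by positivity)]; linarith [hs.2]
    have hBs : 0 ≤ (s - t) * B := mul_nonneg hs0 hB0
    rw [Real.norm_eq_abs, Real.norm_eq_abs, smul_eq_mul, abs_of_nonneg hs0]
    have hidx : ∀ r, 0 ≤ r → Tendsto (fun n : ℕ => (eulerIndex n r : ℝ) * (1 / ((n : ℝ) + 1))) U
        (𝓝 r) := by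
      intro r hr
      have h1 : Tendsto (fun n : ℕ => r - 1 / ((n : ℝ) + 1)) U (𝓝 (r - 0)) := hstep.const_sub r
      rw [sub_zero] at h1
      exact tendsto_of_tendsto_of_tendsto_of_le_of_le h1 tendsto_const_nhds
        (fun n => (lt_eulerIndex_mul n r).le) fun n => eulerIndex_mul_le n hr
    have hd := (hidx s (ht.trans hs.1)).sub (hidx t ht)
    have hl := (((hζ s).sub (hζ t)).sub (hd.mul_const (f t (ζ t)))).abs
    have hr := hd.mul_const ε
    rw [mul_comm (s - t) ε] at hr
    have hmain : ∀ᶠ n in (U : Filter ℕ), |eulerApprox f n s - eulerApprox f n t -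
        ((eulerIndex n s : ℝ) * (1 / ((n : ℝ) + 1)) - eulerIndex n t * (1 / ((n : ℝ) + 1))) *
          f t (ζ t)| ≤
        ((eulerIndex n s : ℝ) * (1 / ((n : ℝ) + 1)) - eulerIndex n t * (1 / ((n : ℝ) + 1))) * ε := by
      have e1 : ∀ᶠ n in (U : Filter ℕ), |eulerApprox f n t - ζ t| < δ / 4 := by
        have := Metric.tendsto_nhds.1 (hζ t) (δ / 4) (by positivity)
        simpa only [Real.dist_eq] using this
      have e2 : ∀ᶠ n : ℕ in (U : Filter ℕ), 1 / ((n : ℝ) + 1) < δ / (4 * (B + 1)) :=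
        hstep.eventually (gt_mem_nhds hpos)
      filter_upwards [e1, e2] with n hn1 hn2
      have hh : (0 : ℝ) ≤ 1 / ((n : ℝ) + 1) := by positivity
      have hhd : 1 / ((n : ℝ) + 1) * (4 * (B + 1)) < δ := by
        rw [← lt_div_iff₀ (by positivity)]; exact hn2
      have hhB : 0 ≤ 1 / ((n : ℝ) + 1) * B := mul_nonneg hh hB0
      have := abs_eulerNode_sub_le (f := f) (c := f t (ζ t)) (ε := ε) hh (eulerIndex_mono n hs.1)
        (by
          intro i hi1 hi2
          have hi1' : (eulerIndex n t : ℝ) ≤ i := by exact_mod_cast hi1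
          have hi2' : (i : ℝ) ≤ eulerIndex n s := by exact_mod_cast hi2.le
          have a1 := mul_le_mul_of_nonneg_right hi1' hh
          have a2 := mul_le_mul_of_nonneg_right hi2' hh
          have a3 := lt_eulerIndex_mul n t
          have a4 := eulerIndex_mul_le n (ht.trans hs.1)
          have a5 := eulerIndex_mul_le n ht
          have b1 := abs_eulerNode_sub_le (f := f) (c := 0) (ε := B) hh hi1
            fun i _ _ => by simpa using hB _ _
          rw [mul_zero, sub_zero] at b1
          have b2 : ((i : ℝ) - eulerIndex n t) * (1 / ((n : ℝ) + 1)) * B ≤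
              (s - t + 1 / ((n : ℝ) + 1)) * B :=
            mul_le_mul_of_nonneg_right (by linarith) hB0
          have b3 : |eulerNode f (1 / ((n : ℝ) + 1)) i - ζ t| < δ := by
            have : eulerNode f (1 / ((n : ℝ) + 1)) i - ζ t =
              (eulerNode f (1 / ((n : ℝ) + 1)) i - eulerNode f (1 / ((n : ℝ) + 1)) (eulerIndex n t))
                + (eulerApprox f n t - ζ t) := by rw [eulerApprox]; ring
            rw [this]
            refine (abs_add_le _ _).trans_lt ?_
            nlinarith
          have b4 : |(i : ℝ) * (1 / ((n : ℝ) + 1)) - t| < δ := by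
            rw [abs_lt]; constructor <;> nlinarith
          have := @hcont ((i : ℝ) * (1 / ((n : ℝ) + 1)), eulerNode f (1 / ((n : ℝ) + 1)) i) (by
            rw [Prod.dist_eq, max_lt_iff, Real.dist_eq, Real.dist_eq]
            exact ⟨b4, b3⟩)
          rw [Real.dist_eq] at this
          exact this.le)
      simpa only [sub_mul, eulerApprox] using this
    exact le_of_tendsto_of_tendsto hl hr hmain

end Peano

/-! ### Hölder graphs in coordinates and their integral curves -/

section Model

variable {E V : Type*} [NormedAddCommGroup E] [NormedAddCommGroup V]

/-- The homogeneous gauge on the vertical subgroup in coordinates `E × V`. -/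
def gauge (q : E × V) : ℝ := ‖q.1‖ + √‖q.2‖

theorem gauge_nonneg (q : E × V) : 0 ≤ gauge q := add_nonneg (norm_nonneg _) (Real.sqrt_nonneg _)

theorem gauge_zero : gauge (0 : E × V) = 0 := by simp [gauge]

theorem gauge_le {q : E × V} {A r : ℝ} (hA : 1 ≤ A) (hr : 0 ≤ r) (h1 : ‖q.1‖ ≤ A * r)
    (h2 : ‖q.2‖ ≤ A * r ^ 2) : gauge q ≤ 2 * A * r := by
  have h3 : √‖q.2‖ ≤ A * r := by
    refine Real.sqrt_le_iff.2 ⟨by positivity, h2.trans ?_⟩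
    nlinarith [mul_nonneg (sub_nonneg.2 hA) (sq_nonneg r)]
  rw [gauge]
  linarith

variable [NormedSpace ℝ E] [NormedSpace ℝ V]

/-- The conjugated translation `q ↦ p v^c q v^{-c}` of the vertical subgroup, in coordinates. -/
def move (lam : E →L[ℝ] V) (bet : E →L[ℝ] E →L[ℝ] V) (c : ℝ) (p q : E × V) : E × V :=
  (p.1 + q.1, p.2 + q.2 + c • lam q.1 + (1 / 2 : ℝ) • bet p.1 q.1)

/-- The properties of a function `F` with intrinsic differential `D` of class `C^{1,α}`, expressed
in coordinates on the vertical subgroup. -/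
structure IsHolderGraph (lam : E →L[ℝ] V) (bet : E →L[ℝ] E →L[ℝ] V) (α H L : ℝ)
    (F : E × V → ℝ) (D : E × V → StrongDual ℝ E) : Prop where
  continuous : Continuous F
  diff : ∀ p, ∀ ε > 0, ∀ᶠ q in 𝓝 (0 : E × V),
    |F (move lam bet (F p) p q) - F p - D p q.1| ≤ ε * gauge q
  holder : ∀ p q, ‖D (move lam bet (F p) p q) - D p‖ ≤ H * gauge q ^ α
  bound : ∀ p, ‖D p‖ ≤ L

variable {lam : E →L[ℝ] V} {bet : E →L[ℝ] E →L[ℝ] V} {α H L : ℝ} {F : E × V → ℝ}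
  {D : E × V → StrongDual ℝ E}

/-- This is associativity in the group: (p vᶜ)(q vᵈ) = (p vᶜ q v⁻ᶜ) vᶜ⁺ᵈ. -/
theorem move_move (c d : ℝ) (p q r : E × V) :
    move lam bet c p (move lam bet d q r) = move lam bet (d + c) (move lam bet c p q) r := by
  ext
  · simp [move, add_assoc]
  · simp only [move, map_add, smul_add, add_smul, add_apply]
    abel

theorem continuous_move (c : ℝ) (p : E × V) : Continuous (move lam bet c p) := by
  unfold move
  fun_prop

theorem move_zero_right (c : ℝ) (p : E × V) : move lam bet c p 0 = p := by
  ext <;> simp [move]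

theorem move_zero_left (q : E × V) : move lam bet 0 0 q = q := by
  ext <;> simp [move]

/-- Left invariance with unchanged constants, which allows any graph point to be moved to the
origin. -/
theorem IsHolderGraph.translate (h : IsHolderGraph lam bet α H L F D) (p : E × V) :
    IsHolderGraph lam bet α H L (fun q => F (move lam bet (F p) p q) - F p)
      (fun q => D (move lam bet (F p) p q)) where
  continuous := (h.continuous.comp (continuous_move _ _)).sub continuous_const
  diff q ε hε := by
    simpa only [move_move, sub_add_cancel, sub_sub_sub_cancel_right] using h.diff _ ε hε
  holder q r := by simpa only [move_move, sub_add_cancel] using h.holder (move lam bet (F p) p q) r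
  bound q := h.bound _

/-- A curve in direction `e` from `p`, with vertical deviation `ζ` along `lam e`. -/
def curve (lam : E →L[ℝ] V) (bet : E →L[ℝ] E →L[ℝ] V) (p : E × V) (e : E) (ζ : ℝ → ℝ) (t : ℝ) :
    E × V :=
  (p.1 + t • e, p.2 + ζ t • lam e + (t / 2) • bet p.1 e)

theorem continuous_curve (p : E × V) (e : E) {ζ : ℝ → ℝ} (hζ : Continuous ζ) :
    Continuous (curve lam bet p e ζ) := by
  unfold curve
  fun_prop

theorem curve_zero (p : E × V) (e : E) {ζ : ℝ → ℝ} (hζ : ζ 0 = 0) : curve lam bet p e ζ 0 = p := by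
  ext <;> simp [curve, hζ]

/-- Seen from its point at time `s`, the curve is horizontal up to the deviation of `ζ` from the
line of slope `c`. Since `bet` is alternating, the displacement along `e` produces no further
vertical term. -/
theorem curve_eq_move (hbet : ∀ x, bet x x = 0) (p : E × V) (e : E) (ζ : ℝ → ℝ) (c s t : ℝ) :
    curve lam bet p e ζ t = move lam bet c (curve lam bet p e ζ s)
      ((t - s) • e, (ζ t - ζ s - (t - s) * c) • lam e) := by
  ext
  · simp only [curve, move]
    module
  · simp only [curve, move, map_smul, map_add, add_apply, hbet,
      smul_apply, smul_zero, add_zero]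
    module

/-- Along an integral curve, `F` is differentiable with derivative given by the intrinsic
differential. -/
theorem IsHolderGraph.hasDerivWithinAt_curve (h : IsHolderGraph lam bet α H L F D)
    (hbet : ∀ x, bet x x = 0) {p : E × V} {e : E} {ζ : ℝ → ℝ} (hζ : Continuous ζ) {a b : ℝ}
    (hab : a < b)
    (hd : ∀ t ∈ Ico a b, HasDerivWithinAt ζ (F (curve lam bet p e ζ t)) (Ici t) t) :
    HasDerivWithinAt (fun t => F (curve lam bet p e ζ t)) (D (curve lam bet p e ζ a) e)
      (Ici a) a := by
  set γ := curve lam bet p e ζ with hγ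
  set c := F (γ a) with hc
  set l := ‖lam e‖ with hl
  set η : ℝ → ℝ := fun t => ζ t - ζ a - (t - a) * c with hη
  have hl0 : 0 ≤ l := norm_nonneg _
  have hγc : Continuous γ := continuous_curve p e hζ
  have hFc : Continuous fun t => F (γ t) := h.continuous.comp hγc
  have hηc : Continuous η := by fun_prop
  have hηd : ∀ t ∈ Ico a b, HasDerivWithinAt η (F (γ t) - c) (Ici t) t := by
    intro t ht
    have h1 := ((hd t ht).sub_const (ζ a)).sub
      (((hasDerivWithinAt_id t (Ici t)).sub_const a).mul_const c)
    rwa [one_mul] at h1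
  have hηb : ∀ m, ∀ t ∈ Icc a b, (∀ s ∈ Ico a t, |F (γ s) - c| ≤ m) → |η t| ≤ m * (t - a) := by
    intro m t ht hm
    have := norm_image_sub_le_of_norm_deriv_right_le_segment (f := η) (a := a) (b := t)
      hηc.continuousOn (fun s hs => hηd s ⟨hs.1, hs.2.trans_le ht.2⟩) hm t ⟨ht.1, le_rfl⟩
    simpa [hη] using this
  have hest : ∀ ε > 0, ∀ᶠ t in 𝓝[≥] a, |F (γ t) - c - (t - a) * D (γ a) e| ≤
      ε * ((t - a) * ‖e‖ + √(|η t| * l)) := by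
    intro ε hε
    have h1 : Tendsto (fun t => ((t - a) • e, η t • lam e)) (𝓝[≥] a) (𝓝 (0 : E × V)) := by
      have hcont : Continuous fun t => (((t - a) • e, η t • lam e) : E × V) := by fun_prop
      have := hcont.tendsto a
      simp only [hη, sub_self, zero_smul, zero_mul] at this
      exact this.mono_left nhdsWithin_le_nhds
    filter_upwards [h1.eventually (h.diff (γ a) ε hε), self_mem_nhdsWithin] with t ht hta
    rw [← curve_eq_move hbet] at ht
    have hta' : 0 ≤ t - a := sub_nonneg.2 hta
    simpa [gauge, norm_smul, abs_of_nonneg hta'] using ht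
  -- The deviation `η` enters through its square root, so it must be quadratic in `t - a`;
  -- continuity of `F` alone gives only o(t - a). A bootstrap first shows that `F ∘ γ` is Lipschitz
  -- at `a`.
  obtain ⟨C, hC0, hC⟩ : ∃ C, 0 ≤ C ∧ ∃ b' > a, b' ≤ b ∧
      ∀ t ∈ Ico a b', |F (γ t) - c| ≤ C * (t - a) := by
    obtain ⟨b₁, hb₁, hb₁'⟩ := (mem_nhdsGE_iff_exists_Ico_subset).1 (hest 1 one_pos)
    refine ⟨2 * (|D (γ a) e| + ‖e‖) + l, by positivity, min b b₁, lt_min hab hb₁, min_le_left _ _,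
      fun t ht => ?_⟩
    have ht0 : 0 ≤ t - a := sub_nonneg.2 ht.1
    obtain ⟨s, hs, hmax⟩ := isCompact_Icc.exists_isMaxOn (nonempty_Icc.2 ht.1)
      (f := fun t => |F (γ t) - c|) (hFc.sub continuous_const).abs.continuousOn
    set m := |F (γ s) - c| with hm
    have hle : ∀ u ∈ Icc a t, |F (γ u) - c| ≤ m := fun u hu => hmax hu
    have hsa : 0 ≤ s - a := sub_nonneg.2 hs.1
    have hst : s - a ≤ t - a := sub_le_sub_right hs.2 a
    have hm0 : 0 ≤ m := abs_nonneg _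
    have hηs : |η s| ≤ m * (t - a) :=
      (hηb m s ⟨hs.1, hs.2.trans (ht.2.le.trans (min_le_left _ _))⟩
        fun u hu => hle u ⟨hu.1, hu.2.le.trans hs.2⟩).trans (mul_le_mul_of_nonneg_left hst hm0)
    have h2 : |F (γ s) - c - (s - a) * D (γ a) e| ≤ 1 * ((s - a) * ‖e‖ + √(|η s| * l)) :=
      hb₁' ⟨hs.1, hs.2.trans_lt (ht.2.trans_le (min_le_right _ _))⟩
    -- By the arithmetic-geometric mean inequality, half of the maximum `m` is absorbed on the left;
    -- doubling the rest gives the constant `C`.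
    have h3 : √(|η s| * l) ≤ (m + (t - a) * l) / 2 := by
      refine Real.sqrt_le_iff.2 ⟨by positivity, ?_⟩
      have := mul_le_mul_of_nonneg_right hηs hl0
      nlinarith [sq_nonneg (m - (t - a) * l)]
    have h4 : m ≤ |F (γ s) - c - (s - a) * D (γ a) e| + |(s - a) * D (γ a) e| := by
      rw [hm]
      simpa using abs_add_le (F (γ s) - c - (s - a) * D (γ a) e) ((s - a) * D (γ a) e)
    rw [abs_mul, abs_of_nonneg hsa] at h4
    have h5 := mul_le_mul_of_nonneg_right hst (abs_nonneg (D (γ a) e))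
    have h6 := mul_le_mul_of_nonneg_right hst (norm_nonneg e)
    have h7 := hle t ⟨ht.1, le_rfl⟩
    nlinarith
  obtain ⟨b', hab', hbb', hC⟩ := hC
  rw [hasDerivWithinAt_iff_isLittleO, Asymptotics.isLittleO_iff]
  intro ε hε
  have hε' : 0 < ε / (‖e‖ + √(C * l) + 1) := by positivity
  filter_upwards [hest _ hε', Ico_mem_nhdsGE hab'] with t ht htb
  have ht0 : 0 ≤ t - a := sub_nonneg.2 htb.1
  have h1 : |η t| ≤ C * (t - a) * (t - a) :=
    hηb _ t ⟨htb.1, htb.2.le.trans hbb'⟩ fun s hs =>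
      (hC s ⟨hs.1, hs.2.trans htb.2⟩).trans (by gcongr; exact hs.2.le)
  have h2 : √(|η t| * l) ≤ (t - a) * √(C * l) := by
    refine Real.sqrt_le_iff.2 ⟨by positivity, ?_⟩
    rw [mul_pow, Real.sq_sqrt (by positivity)]
    nlinarith [mul_le_mul_of_nonneg_right h1 hl0]
  rw [Real.norm_eq_abs, Real.norm_eq_abs, smul_eq_mul, abs_of_nonneg ht0]
  refine ht.trans ?_
  rw [div_mul_eq_mul_div, div_le_iff₀ (by positivity), mul_assoc]
  refine mul_le_mul_of_nonneg_left ?_ hε.le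
  nlinarith

/-- Integral curves exist on every bounded interval. -/
theorem IsHolderGraph.exists_curve (h : IsHolderGraph lam bet α H L F D)
    (hbet : ∀ x, bet x x = 0) (p : E × V) (e : E) (T : ℝ) :
    ∃ ζ : ℝ → ℝ, ζ 0 = 0 ∧ Continuous ζ ∧ ∀ t ∈ Ico 0 T,
      HasDerivWithinAt ζ (F (curve lam bet p e ζ t)) (Ici t) t ∧
      HasDerivWithinAt (fun t => F (curve lam bet p e ζ t)) (D (curve lam bet p e ζ t) e)
        (Ici t) t := by
  have hL0 : 0 ≤ L := (norm_nonneg _).trans (h.bound 0)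
  -- `F` is truncated at `±B` so that Peano's theorem applies. The bound exceeds every value that
  -- `F` can reach along the curve up to time `T`.
  set B : ℝ := |F p| + L * ‖e‖ * |T| + 1 with hB
  have hB0 : 0 ≤ B := by positivity
  have hFc := h.continuous
  obtain ⟨ζ, hζ0, hζc, hζd⟩ := exists_forall_hasDerivWithinAt_Ici
    (f := fun t y => max (-B) (min B (F (p.1 + t • e, p.2 + y • lam e + (t / 2) • bet p.1 e))))
    (by unfold Function.uncurry; fun_prop) (B := B) (by
      intro t y
      rw [abs_le]
      exact ⟨le_max_left _ _, max_le (by linarith) (min_le_left _ _)⟩)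
  set γ := curve lam bet p e ζ with hγ
  have hγF : Continuous fun t => F (γ t) := hFc.comp (continuous_curve p e hζc)
  have hζd' : ∀ t, 0 ≤ t → |F (γ t)| < B → HasDerivWithinAt ζ (F (γ t)) (Ici t) t := by
    intro t ht hlt
    have h1 := hζd t ht
    have h2 := abs_lt.1 hlt
    have h3 : max (-B) (min B (F (γ t))) = F (γ t) := by
      rw [min_eq_right h2.2.le, max_eq_right h2.1.le]
    exact h3 ▸ h1
  have hFd : ∀ t, 0 ≤ t → |F (γ t)| < B →
      HasDerivWithinAt (fun t => F (γ t)) (D (γ t) e) (Ici t) t := by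
    intro t ht hlt
    have hev : ∀ᶠ s in 𝓝[≥] t, |F (γ s)| < B :=
      nhdsWithin_le_nhds (hγF.abs.tendsto t |>.eventually (gt_mem_nhds hlt))
    obtain ⟨b, hb, hb'⟩ := (mem_nhdsGE_iff_exists_Ico_subset).1 hev
    exact h.hasDerivWithinAt_curve hbet hζc hb fun s hs => hζd' s (ht.trans hs.1) (hb' hs)
  -- Before the first time with `|F| ≥ B` the truncation is inactive, so `F ∘ γ` grows at rate at
  -- most `L * ‖e‖` and cannot have reached `B`.
  have hlt : ∀ t ∈ Icc 0 T, |F (γ t)| < B := by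
    by_contra! hcon
    have hcl : IsClosed {t | B ≤ |F (γ t)|} := isClosed_le continuous_const hγF.abs
    have hcomp : IsCompact (Icc 0 T ∩ {t | B ≤ |F (γ t)|}) := isCompact_Icc.inter_right hcl
    obtain ⟨t, ⟨htI, htB⟩, hmin⟩ := hcomp.exists_isLeast hcon
    have hlt : ∀ s ∈ Ico 0 t, |F (γ s)| < B := by
      intro s hs
      by_contra! hsB
      exact absurd (hmin ⟨⟨hs.1, hs.2.le.trans htI.2⟩, hsB⟩) (not_le.2 hs.2)
    have h1 := norm_image_sub_le_of_norm_deriv_right_le_segment (C := L * ‖e‖) (b := t)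
      hγF.continuousOn (fun s hs => hFd s hs.1 (hlt s hs))
      (fun s _ => ((D (γ s)).le_opNorm e).trans
        (mul_le_mul_of_nonneg_right (h.bound _) (norm_nonneg _))) t ⟨htI.1, le_rfl⟩
    rw [hγ, curve_zero p e hζ0, sub_zero, Real.norm_eq_abs, ← hγ] at h1
    have h2 : |F (γ t)| ≤ |F (γ t) - F p| + |F p| := by
      simpa using abs_add_le (F (γ t) - F p) (F p)
    have h3 : L * ‖e‖ * t ≤ L * ‖e‖ * |T| := by
      gcongr
      exact htI.2.trans (le_abs_self T)
    have h4 : B ≤ |F (γ t)| := htB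
    linarith
  exact ⟨ζ, hζ0, hζc, fun t ht => ⟨hζd' t ht.1 (hlt t ⟨ht.1, ht.2.le⟩),
    hFd t ht.1 (hlt t ⟨ht.1, ht.2.le⟩)⟩⟩

end Model

/-! ### Vertical oscillation in the directions [X 0, y] -/

section Vertical

/-- The gap between two characteristics cannot close too quickly. -/
theorem sq_le_of_gap {h k k' : ℝ → ℝ} {s m G α : ℝ} (hs : 0 < s) (hm : 0 < m) (hα : 0 ≤ α)
    (hG : 0 ≤ G) (hhc : Continuous h) (hkc : Continuous k) (h0 : h 0 = s) (k0 : k 0 = -m)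
    (hh : ∀ t ∈ Ico 0 (2 * s / m), HasDerivWithinAt h (k t) (Ici t) t)
    (hk : ∀ t ∈ Ico 0 (2 * s / m), HasDerivWithinAt k (k' t) (Ici t) t)
    (hk' : ∀ t, |k' t| ≤ G * √|h t| ^ α) (hz : ∀ t, h t = 0 → k t = 0) :
    m ^ 2 ≤ 4 * (G * √s ^ α) * s := by
  by_contra! hcon
  set K := G * √s ^ α with hK
  set T := 2 * s / m with hT
  have hK0 : 0 ≤ K := by positivity
  have hT0 : 0 ≤ T := by positivity
  have hKT : K * T < m / 2 := by
    rw [hT, mul_div_assoc', div_lt_iff₀ hm]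
    nlinarith
  -- While `h > 0` and `k < -m/2`, the gap decreases and stays below `s`. Hence `|k'| ≤ K`, and `K *
  -- T < m / 2` preserves the bound on `k`.
  have key : ∀ u ∈ Icc 0 T, (∀ t ∈ Ico 0 u, 0 < h t ∧ k t < -(m / 2)) →
      h u ≤ s - m / 2 * u ∧ k u < -(m / 2) := by
    intro u hu hpos
    have hle : ∀ t ∈ Icc 0 u, h t ≤ s - m / 2 * t := by
      have hb : ∀ t, HasDerivAt (fun t => s - m / 2 * t) (-(m / 2)) t := fun t => by
        simpa using ((hasDerivAt_id t).const_mul (m / 2)).const_sub s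
      exact fun t ht => image_le_of_deriv_right_le_deriv_boundary hhc.continuousOn
        (fun t ht => hh t ⟨ht.1, ht.2.trans_le hu.2⟩) (by simp [h0])
        (fun t _ => (hb t).continuousAt.continuousWithinAt) (fun t _ => (hb t).hasDerivWithinAt)
        (fun t ht => (hpos t ht).2.le) ht
    have hku := norm_image_sub_le_of_norm_deriv_right_le_segment (C := K) (b := u)
      hkc.continuousOn (fun t ht => hk t ⟨ht.1, ht.2.trans_le hu.2⟩) (fun t ht => by
        refine (hk' t).trans (mul_le_mul_of_nonneg_left ?_ hG)
        refine Real.rpow_le_rpow (Real.sqrt_nonneg _) (Real.sqrt_le_sqrt ?_) hα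
        rw [abs_of_pos (hpos t ht).1]
        have := hle t ⟨ht.1, ht.2.le⟩
        have h2 : 0 ≤ m / 2 * t := mul_nonneg (by positivity) ht.1
        linarith) u ⟨hu.1, le_rfl⟩
    rw [k0, sub_zero, Real.norm_eq_abs] at hku
    have h3 := (abs_le.1 hku).2
    have h4 : K * u ≤ K * T := mul_le_mul_of_nonneg_left hu.2 hK0
    exact ⟨hle u ⟨hu.1, le_rfl⟩, by linarith⟩
  -- The regime must end by time `T`, where the upper bound on `h` is zero. By `key` it ends with
  -- `h` vanishing while `k < -m/2`, contrary to `hz`.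
  have hne : (Icc 0 T ∩ {t | h t ≤ 0 ∨ -(m / 2) ≤ k t}).Nonempty := by
    by_contra! hemp
    have hgood : ∀ t ∈ Icc 0 T, 0 < h t ∧ k t < -(m / 2) := by
      intro t ht
      by_contra hcon'
      rw [not_and_or, not_lt, not_lt] at hcon'
      exact hemp.subset (⟨ht, hcon'⟩ : t ∈ Icc 0 T ∩ {t | h t ≤ 0 ∨ -(m / 2) ≤ k t})
    have h1 := (key T ⟨hT0, le_rfl⟩ fun t ht => hgood t ⟨ht.1, ht.2.le⟩).1
    have h2 := (hgood T ⟨hT0, le_rfl⟩).1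
    have h3 : m / 2 * T = s := by rw [hT]; field_simp
    linarith
  have hcomp : IsCompact (Icc 0 T ∩ {t | h t ≤ 0 ∨ -(m / 2) ≤ k t}) :=
    isCompact_Icc.inter_right
      ((isClosed_le hhc continuous_const).union (isClosed_le continuous_const hkc))
  obtain ⟨u, ⟨hu, hu'⟩, hmin⟩ := hcomp.exists_isLeast hne
  have hku := (key u hu fun t ht => by
    by_contra hcon'
    rw [not_and_or, not_lt, not_lt] at hcon'
    exact absurd (hmin ⟨⟨ht.1, ht.2.le.trans hu.2⟩, hcon'⟩) (not_le.2 ht.2)).2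
  have hhu : h u ≤ 0 := hu'.resolve_right (not_le.2 hku)
  obtain ⟨t, ht, ht0⟩ := intermediate_value_Icc' hu.1 hhc.continuousOn
    (⟨hhu, h0 ▸ hs.le⟩ : (0 : ℝ) ∈ Icc (h u) (h 0))
  have htu : t = u := le_antisymm ht.2 (hmin ⟨⟨ht.1, ht.2.trans hu.2⟩, Or.inl ht0.le⟩)
  have := hz t ht0
  rw [htu] at this
  linarith

/-- Replacing `B ^ α` by `B` keeps the constants independent of `α`. -/
theorem mul_rpow_le {α a B : ℝ} (hα : α ∈ Icc (0 : ℝ) 1) (ha : 0 ≤ a) (hB : 1 ≤ B) :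
    (B * a) ^ α ≤ B * a ^ α := by
  rw [Real.mul_rpow (by linarith) ha]
  refine mul_le_mul_of_nonneg_right ?_ (by positivity)
  simpa using Real.rpow_le_rpow_of_exponent_le hB hα.2

/-- The modulus `max {ρ^{1+α}, ρ^{1+α/2}}`. -/
def growth (α ρ : ℝ) : ℝ := max (ρ ^ (1 + α)) (ρ ^ (1 + α / 2))

theorem growth_nonneg (α : ℝ) {ρ : ℝ} (hρ : 0 ≤ ρ) : 0 ≤ growth α ρ :=
  (Real.rpow_nonneg hρ _).trans (le_max_left _ _)

theorem growth_mono {α ρ σ : ℝ} (hα : 0 ≤ α) (hρ : 0 ≤ ρ) (h : ρ ≤ σ) :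
    growth α ρ ≤ growth α σ :=
  max_le_max (Real.rpow_le_rpow hρ h (by positivity)) (Real.rpow_le_rpow hρ h (by positivity))

theorem growth_mul_le {α ρ k : ℝ} (hα : α ∈ Icc (0 : ℝ) 1) (hρ : 0 ≤ ρ) (hk : 1 ≤ k) :
    growth α (k * ρ) ≤ k ^ 2 * growth α ρ := by
  have h1 : ∀ β : ℝ, β ≤ 2 → (k * ρ) ^ β ≤ k ^ 2 * ρ ^ β := by
    intro β hβ
    rw [Real.mul_rpow (by linarith) hρ]
    refine mul_le_mul_of_nonneg_right ?_ (by positivity)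
    simpa using Real.rpow_le_rpow_of_exponent_le hk hβ
  refine max_le ((h1 _ (by linarith [hα.2])).trans ?_)
    ((h1 _ (by linarith [hα.1, hα.2])).trans ?_)
  · exact mul_le_mul_of_nonneg_left (le_max_left _ _) (by positivity)
  · exact mul_le_mul_of_nonneg_left (le_max_right _ _) (by positivity)

variable {E V : Type*} [NormedAddCommGroup E] [NormedAddCommGroup V] [NormedSpace ℝ E]
  [NormedSpace ℝ V] {lam : E →L[ℝ] V} {bet : E →L[ℝ] E →L[ℝ] V} {α H L : ℝ} {F : E × V → ℝ}
  {D : E × V → StrongDual ℝ E}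

/-- Integral curves in direction `e` from the two points differ only by a multiple of `lam e`, so
`sq_le_of_gap` applies to that multiple. The estimate is one-sided because the argument needs the
gap to be closing. -/
theorem IsHolderGraph.sub_vertical_le (h : IsHolderGraph lam bet α H L F D)
    (hbet : ∀ x, bet x x = 0) (hα : α ∈ Icc (0 : ℝ) 1) (hH : 0 ≤ H) (p : E × V) {e : E}
    (he : ‖e‖ ≤ 1) {s : ℝ} (hs : 0 < s) :
    F p - F (p.1, p.2 + s • lam e) ≤ 2 * √(H * (1 + ‖lam‖)) * √s ^ (1 + α / 2) := by
  set p' : E × V := (p.1, p.2 + s • lam e) with hp'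
  set m := F p - F p' with hm
  rcases le_or_gt m 0 with hm0 | hm0
  · exact hm0.trans (by positivity)
  obtain ⟨ζ, hζ0, hζc, hζd⟩ := h.exists_curve hbet p e (2 * s / m)
  obtain ⟨ξ, hξ0, hξc, hξd⟩ := h.exists_curve hbet p' e (2 * s / m)
  set γ := curve lam bet p e ζ with hγ
  set δ := curve lam bet p' e ξ with hδ
  have hmove : ∀ t, δ t = move lam bet (F (γ t)) (γ t) (0, (s + ξ t - ζ t) • lam e) := by
    intro t
    ext
    · simp [hγ, hδ, curve, move, hp']
    · simp only [hγ, hδ, curve, move, hp', map_zero, smul_zero, add_zero]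
      module
  have hΛ : 1 ≤ 1 + ‖lam‖ := by linarith [norm_nonneg lam]
  have hlam : ‖lam e‖ ≤ 1 + ‖lam‖ := (lam.le_of_opNorm_le_of_le (by linarith) he).trans (by linarith)
  have hsq : m ^ 2 ≤ 4 * (H * (1 + ‖lam‖) * √s ^ α) * s := by
    refine sq_le_of_gap (h := fun t => s + ξ t - ζ t) (k := fun t => F (δ t) - F (γ t))
      (k' := fun t => D (δ t) e - D (γ t) e) hs hm0 hα.1 (by positivity) (by fun_prop)
      ((h.continuous.comp (continuous_curve _ _ hξc)).sub
        (h.continuous.comp (continuous_curve _ _ hζc))) (by simp [hξ0, hζ0]) ?_ ?_ ?_ ?_ ?_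
    · simp only [hγ, hδ, curve_zero _ _ hζ0, curve_zero _ _ hξ0, hm, neg_sub]
    · exact fun t ht => ((hξd t ht).1.const_add s).sub (hζd t ht).1
    · exact fun t ht => (hξd t ht).2.sub (hζd t ht).2
    · intro t
      have h1 : |D (δ t) e - D (γ t) e| ≤ ‖D (δ t) - D (γ t)‖ := by
        have := (D (δ t) - D (γ t)).le_of_opNorm_le_of_le le_rfl he
        simpa using this
      refine h1.trans ?_
      have h2 := h.holder (γ t) (0, (s + ξ t - ζ t) • lam e)
      rw [← hmove] at h2
      refine h2.trans ?_
      rw [mul_assoc]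
      refine mul_le_mul_of_nonneg_left ?_ hH
      refine le_trans ?_ (mul_rpow_le hα (Real.sqrt_nonneg _) hΛ)
      refine Real.rpow_le_rpow (gauge_nonneg _) ?_ hα.1
      simp only [gauge, norm_zero, zero_add, norm_smul, Real.norm_eq_abs]
      refine Real.sqrt_le_iff.2 ⟨by positivity, ?_⟩
      rw [mul_pow, Real.sq_sqrt (abs_nonneg _)]
      nlinarith [mul_le_mul_of_nonneg_left hlam (abs_nonneg (s + ξ t - ζ t)),
        mul_nonneg (norm_nonneg lam) (abs_nonneg (s + ξ t - ζ t)),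
        mul_nonneg (sq_nonneg ‖lam‖) (abs_nonneg (s + ξ t - ζ t))]
    · intro t ht
      have h1 := hmove t
      rw [ht, zero_smul] at h1
      have h2 : δ t = γ t := h1.trans (move_zero_right _ _)
      simp [h2]
  refine (pow_le_pow_iff_left₀ hm0.le (by positivity) two_ne_zero).1 (hsq.trans_eq ?_)
  have hs' : 0 < √s := Real.sqrt_pos.2 hs
  have h3 : (√s ^ (1 + α / 2)) ^ 2 = √s ^ α * s := by
    rw [← Real.rpow_natCast, ← Real.rpow_mul hs'.le,
      show (1 + α / 2) * ((2 : ℕ) : ℝ) = α + (2 : ℕ) by push_cast; ring,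
      Real.rpow_add hs', Real.rpow_natCast, Real.sq_sqrt hs.le]
  rw [mul_pow, mul_pow, h3, Real.sq_sqrt (by positivity)]
  ring

/-- Vertical estimate in the directions `[X 0, y]`. -/
theorem IsHolderGraph.abs_sub_lam_le (h : IsHolderGraph lam bet α H L F D)
    (hbet : ∀ x, bet x x = 0) (hα : α ∈ Icc (0 : ℝ) 1) (hH : 0 ≤ H) (p : E × V) {y : E} {ρ : ℝ}
    (hρ : 0 ≤ ρ) (hy : ‖y‖ ≤ ρ ^ 2) :
    |F (p.1, p.2 + lam y) - F p| ≤ 2 * √(H * (1 + ‖lam‖)) * growth α ρ := by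
  rcases eq_or_ne y 0 with rfl | hy0
  · simpa using mul_nonneg (by positivity) (growth_nonneg α hρ)
  have hs : 0 < ‖y‖ := norm_pos_iff.2 hy0
  have he : ‖(‖y‖⁻¹ • y)‖ ≤ 1 := by rw [norm_smul, norm_inv, norm_norm, inv_mul_cancel₀ hs.ne']
  have hy' : ‖y‖ • lam (‖y‖⁻¹ • y) = lam y := by
    rw [map_smul, smul_inv_smul₀ hs.ne']
  have h1 := h.sub_vertical_le hbet hα hH p he hs
  -- The reversed direction from the other endpoint leads back to `p` and gives the opposite
  -- inequality.
  have h2 := h.sub_vertical_le hbet hα hH (p.1, p.2 + lam y) (e := -(‖y‖⁻¹ • y))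
    (by rwa [norm_neg]) hs
  rw [hy'] at h1
  simp only [map_neg, smul_neg, hy', add_neg_cancel_right] at h2
  have h3 : √‖y‖ ^ (1 + α / 2) ≤ growth α ρ :=
    (Real.rpow_le_rpow (Real.sqrt_nonneg _) (Real.sqrt_le_iff.2 ⟨hρ, hy⟩)
      (by linarith [hα.1])).trans (le_max_right _ _)
  have h4 : 2 * √(H * (1 + ‖lam‖)) * √‖y‖ ^ (1 + α / 2) ≤
      2 * √(H * (1 + ‖lam‖)) * growth α ρ := mul_le_mul_of_nonneg_left h3 (by positivity)
  rw [abs_le]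
  constructor <;> linarith

end Vertical

/-! ### Horizontal segments, commutator loops and the expansion in coordinates -/

section Horizontal

variable {E V : Type*} [NormedAddCommGroup E] [NormedAddCommGroup V] [NormedSpace ℝ E]
  [NormedSpace ℝ V] {lam : E →L[ℝ] V} {bet : E →L[ℝ] E →L[ℝ] V} {α H L : ℝ} {F : E × V → ℝ}
  {D : E × V → StrongDual ℝ E}

/-- The scale reached after following one integral curve from scale `A`. -/
def nextScale (lam : E →L[ℝ] V) (bet : E →L[ℝ] E →L[ℝ] V) (L A : ℝ) : ℝ :=
  A + 1 + L + (A + L) * (1 + ‖lam‖) + A * ‖bet‖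

theorem le_nextScale {A : ℝ} (hL : 0 ≤ L) (hA : 0 ≤ A) :
    A + 1 + L ≤ nextScale lam bet L A := by
  have : 0 ≤ (A + L) * (1 + ‖lam‖) + A * ‖bet‖ := by positivity
  rw [nextScale]
  linarith

/-- Points reached at scale `A r` from the origin. -/
def AtScale (F : E × V → ℝ) (A r : ℝ) (p : E × V) : Prop :=
  ‖p.1‖ ≤ A * r ∧ ‖p.2‖ ≤ A * r ^ 2 ∧ |F p| ≤ A * r

/-- On an integral curve of duration `r`, `F` changes by at most `L * r`, hence `ζ` stays O(r²) and
the gauge O(r). The derivative of `F` along the curve is then within O(r^α) of `D 0 e`, and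
integration gains a factor `r`. -/
theorem IsHolderGraph.exists_segment (h : IsHolderGraph lam bet α H L F D)
    (hbet : ∀ x, bet x x = 0) (hα : α ∈ Icc (0 : ℝ) 1) (hH : 0 ≤ H) (hF0 : F 0 = 0) {A r : ℝ}
    (hA : 0 ≤ A) (hr : 0 ≤ r) {p : E × V} (hp : AtScale F A r p) {e : E} (he : ‖e‖ ≤ 1) :
    ∃ z : ℝ, |z| ≤ nextScale lam bet L A * r ^ 2 ∧
      AtScale F (nextScale lam bet L A) r (p.1 + r • e, p.2 + z • lam e + (r / 2) • bet p.1 e) ∧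
      |F (p.1 + r • e, p.2 + z • lam e + (r / 2) • bet p.1 e) - F p - r * D 0 e| ≤
        2 * H * nextScale lam bet L A * r ^ (1 + α) := by
  have hL : 0 ≤ L := (norm_nonneg _).trans (h.bound 0)
  set A' := nextScale lam bet L A with hA'
  have hAA' : A + 1 + L ≤ A' := le_nextScale hL hA
  obtain ⟨ζ, hζ0, hζc, hζd⟩ := h.exists_curve hbet p e r
  set γ := curve lam bet p e ζ with hγ
  have hγ0 : γ 0 = p := curve_zero p e hζ0
  have hγF : Continuous fun t => F (γ t) := h.continuous.comp (continuous_curve p e hζc)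
  have hF : ∀ t ∈ Icc 0 r, |F (γ t)| ≤ (A + L) * r := by
    intro t ht
    have h1 := norm_image_sub_le_of_norm_deriv_right_le_segment (C := L) hγF.continuousOn
      (fun s hs => (hζd s hs).2) (fun s _ => by
        simpa using (D (γ s)).le_of_opNorm_le_of_le (h.bound _) he) t ht
    rw [hγ0, sub_zero, Real.norm_eq_abs] at h1
    have h2 : |F (γ t)| ≤ |F (γ t) - F p| + |F p| := by
      simpa using abs_add_le (F (γ t) - F p) (F p)
    nlinarith [hp.2.2, mul_le_mul_of_nonneg_left ht.2 hL]
  have hζ : ∀ t ∈ Icc 0 r, |ζ t| ≤ (A + L) * r ^ 2 := by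
    intro t ht
    have h1 := norm_image_sub_le_of_norm_deriv_right_le_segment (C := (A + L) * r) hζc.continuousOn
      (fun s hs => (hζd s hs).1) (fun s hs => hF s ⟨hs.1, hs.2.le⟩) t ht
    rw [hζ0, sub_zero, sub_zero, Real.norm_eq_abs] at h1
    refine h1.trans ?_
    rw [sq, ← mul_assoc]
    exact mul_le_mul_of_nonneg_left ht.2 (by positivity)
  have hAr : (A + 1 + L) * r ≤ A' * r := mul_le_mul_of_nonneg_right hAA' hr
  have hscale : ∀ t ∈ Icc 0 r, AtScale F A' r (γ t) := by
    intro t ht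
    refine ⟨?_, ?_, ?_⟩
    · have h1 : ‖t • e‖ ≤ r * 1 := by
        rw [norm_smul, Real.norm_eq_abs, abs_of_nonneg ht.1]
        exact mul_le_mul ht.2 he (norm_nonneg _) hr
      have h2 : ‖(γ t).1‖ ≤ ‖p.1‖ + ‖t • e‖ := norm_add_le _ _
      nlinarith [hp.1, mul_nonneg hL hr]
    · have h1 : ‖(γ t).2‖ ≤ ‖p.2‖ + ‖ζ t • lam e‖ + ‖(t / 2) • bet p.1 e‖ := norm_add₃_le
      have h2 : ‖ζ t • lam e‖ ≤ ((A + L) * r ^ 2) * (‖lam‖ * 1) := by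
        rw [norm_smul]
        exact mul_le_mul (hζ t ht) (lam.le_of_opNorm_le_of_le le_rfl he) (norm_nonneg _)
          (by positivity)
      have h3 : ‖(t / 2) • bet p.1 e‖ ≤ r * (‖bet‖ * (A * r) * 1) := by
        rw [norm_smul, Real.norm_eq_abs, abs_of_nonneg (by linarith [ht.1] : 0 ≤ t / 2)]
        refine mul_le_mul (by linarith [ht.1, ht.2]) ?_ (norm_nonneg _) hr
        exact (bet p.1).le_of_opNorm_le_of_le (bet.le_of_opNorm_le_of_le le_rfl hp.1) he
      have h4 := hp.2.1
      have h5 : 0 ≤ (1 + L + (A + L)) * r ^ 2 := by positivity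
      rw [hA', nextScale]
      nlinarith
    · have := hF t ht
      nlinarith
  have hr' := hscale r ⟨hr, le_rfl⟩
  have hzr := hζ r ⟨hr, le_rfl⟩
  refine ⟨ζ r, hzr.trans (mul_le_mul_of_nonneg_right (by linarith) (by positivity)), hr', ?_⟩
  have hd : ∀ t ∈ Ico 0 r, HasDerivWithinAt (fun t => F (γ t) - t * D 0 e)
      (D (γ t) e - D 0 e) (Ici t) t := by
    intro t ht
    have := (hζd t ht).2.sub ((hasDerivWithinAt_id t (Ici t)).mul_const (D 0 e))
    rwa [one_mul] at this
  have h1 := norm_image_sub_le_of_norm_deriv_right_le_segment (C := 2 * H * A' * r ^ α)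
    (f := fun t => F (γ t) - t * D 0 e) (hγF.sub (continuous_id.mul continuous_const)).continuousOn hd (fun t ht => by
      have h2 := h.holder 0 (γ t)
      rw [hF0, move_zero_left] at h2
      have h3 : ‖D (γ t) e - D 0 e‖ ≤ ‖D (γ t) - D 0‖ := by
        simpa using (D (γ t) - D 0).le_of_opNorm_le_of_le le_rfl he
      refine h3.trans (h2.trans ?_)
      have h4 := hscale t ⟨ht.1, ht.2.le⟩
      have h5 : gauge (γ t) ^ α ≤ 2 * A' * r ^ α :=
        (Real.rpow_le_rpow (gauge_nonneg _) (gauge_le (by linarith) hr h4.1 h4.2.1) hα.1).trans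
          (mul_rpow_le hα hr (by linarith))
      nlinarith) r ⟨hr, le_rfl⟩
  rw [hγ0, zero_mul, sub_zero, sub_zero, Real.norm_eq_abs, mul_assoc _ _ r] at h1
  have h6 : r ^ α * r = r ^ (1 + α) := by
    rw [add_comm 1 α, Real.rpow_add_one' hr (by linarith [hα.1])]
  rw [h6] at h1
  rw [sub_right_comm]
  exact h1

/-- Following `a`, `b`, `-a`, `-b` in turn, one reaches the direction `[a, b]` up to directions
`[X 0, ·]`. -/
theorem exists_loop (lam : E →L[ℝ] V) {bet : E →L[ℝ] E →L[ℝ] V} (hbet : ∀ x, bet x x = 0)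
    (hH : 0 ≤ H) (hL : 0 ≤ L) :
    ∃ A C : ℝ, 1 ≤ A ∧ 0 ≤ C ∧ ∀ α ∈ Icc (0 : ℝ) 1, ∀ (F : E × V → ℝ) (D : E × V → StrongDual ℝ E),
      IsHolderGraph lam bet α H L F D → F 0 = 0 → ∀ a b : E, ‖a‖ ≤ 1 → ‖b‖ ≤ 1 → ∀ r, 0 ≤ r →
        ∃ l : E, ‖l‖ ≤ A * r ^ 2 ∧ |F (0, r ^ 2 • bet a b + lam l)| ≤ C * r ^ (1 + α) := by
  set N := nextScale lam bet L with hN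
  have hN' : ∀ A, 0 ≤ A → A + 1 + L ≤ N A := fun A hA => le_nextScale hL hA
  set A₁ := N 0
  set A₂ := N A₁
  set A₃ := N A₂
  set A₄ := N A₃
  have g1 : 0 + 1 + L ≤ A₁ := hN' 0 le_rfl
  have g2 : A₁ + 1 + L ≤ A₂ := hN' _ (by linarith)
  have g3 : A₂ + 1 + L ≤ A₃ := hN' _ (by linarith)
  have g4 : A₃ + 1 + L ≤ A₄ := hN' _ (by linarith)
  -- Four vertical deviations and four segment errors, each bounded at the largest scale `A₄`.
  refine ⟨4 * A₄, 4 * (2 * H * A₄), by linarith,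
    mul_nonneg (by norm_num) (mul_nonneg (by linarith) (by linarith)), ?_⟩
  intro α hα F D h hF0 a b ha hb r hr
  have h0 : AtScale F 0 r (0 : E × V) := by simp [AtScale, hF0]
  obtain ⟨z₁, hz₁, hp₁, hF₁⟩ := h.exists_segment hbet hα hH hF0 le_rfl hr h0 ha
  obtain ⟨z₂, hz₂, hp₂, hF₂⟩ := h.exists_segment hbet hα hH hF0 (by linarith) hr hp₁ hb
  obtain ⟨z₃, hz₃, hp₃, hF₃⟩ := h.exists_segment hbet hα hH hF0 (by linarith) hr hp₂
    (e := -a) (by rwa [norm_neg])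
  obtain ⟨z₄, hz₄, hp₄, hF₄⟩ := h.exists_segment hbet hα hH hF0 (by linarith) hr hp₃
    (e := -b) (by rwa [norm_neg])
  refine ⟨(z₁ - z₃) • a + (z₂ - z₄) • b, ?_, ?_⟩
  · have e : ∀ (x y : ℝ) (v : E), ‖v‖ ≤ 1 → ‖(x - y) • v‖ ≤ |x| + |y| := fun x y v hv => by
      rw [norm_smul, Real.norm_eq_abs]
      calc |x - y| * ‖v‖ ≤ |x - y| * 1 := mul_le_mul_of_nonneg_left hv (abs_nonneg _)
        _ ≤ |x| + |y| := by rw [mul_one]; exact abs_sub _ _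
    have e1 := norm_add_le ((z₁ - z₃) • a) ((z₂ - z₄) • b)
    have e2 := e z₁ z₃ a ha
    have e3 := e z₂ z₄ b hb
    have i1 : A₁ * r ^ 2 ≤ A₄ * r ^ 2 := mul_le_mul_of_nonneg_right (by linarith) (sq_nonneg r)
    have i2 : A₂ * r ^ 2 ≤ A₄ * r ^ 2 := mul_le_mul_of_nonneg_right (by linarith) (sq_nonneg r)
    have i3 : A₃ * r ^ 2 ≤ A₄ * r ^ 2 := mul_le_mul_of_nonneg_right (by linarith) (sq_nonneg r)
    linarith
  · have hswap : bet b a = -bet a b := by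
      have := hbet (a + b)
      simp only [map_add, add_apply, hbet, zero_add, add_zero] at this
      exact eq_neg_of_add_eq_zero_left this
    set p₁ : E × V := ((0 : E × V).1 + r • a, (0 : E × V).2 + z₁ • lam a + (r / 2) • bet (0 : E × V).1 a)
    set p₂ : E × V := (p₁.1 + r • b, p₁.2 + z₂ • lam b + (r / 2) • bet p₁.1 b)
    set p₃ : E × V := (p₂.1 + r • -a, p₂.2 + z₃ • lam (-a) + (r / 2) • bet p₂.1 (-a))
    set p₄ : E × V := (p₃.1 + r • -b, p₃.2 + z₄ • lam (-b) + (r / 2) • bet p₃.1 (-b))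
    -- The second and third sides each contribute `(r ^ 2 / 2) • bet a b`; the other two contribute
    -- no bracket.
    have hend : p₄ = (0, r ^ 2 • bet a b + lam ((z₁ - z₃) • a + (z₂ - z₄) • b)) := by
      ext
      · simp [p₄, p₃, p₂, p₁]
      · simp only [p₄, p₃, p₂, p₁, Prod.fst_zero, Prod.snd_zero, zero_add, map_zero,
          zero_apply, smul_zero, add_zero, map_add, map_smul, add_apply,
          smul_apply, map_neg, neg_apply, hbet, hswap]
        module
    rw [← hend]
    rw [hF0, sub_zero] at hF₁
    rw [map_neg, mul_neg] at hF₃ hF₄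
    have j : ∀ A, A ≤ A₄ → 2 * H * A * r ^ (1 + α) ≤ 2 * H * A₄ * r ^ (1 + α) := fun A hA => by
      gcongr
    have j1 := j A₁ (by linarith)
    have j2 := j A₂ (by linarith)
    have j3 := j A₃ (by linarith)
    have k1 := abs_le.1 hF₁
    have k2 := abs_le.1 hF₂
    have k3 := abs_le.1 hF₃
    have k4 := abs_le.1 hF₄
    rw [abs_le]
    constructor <;> linarith [k1.1, k1.2, k2.1, k2.2, k3.1, k3.2, k4.1, k4.2]

theorem move_vertical (c : ℝ) (p : E × V) (u : V) :
    move lam bet c p (0, u) = (p.1, p.2 + u) := by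
  simp [move]

/-- Vertical estimate in the directions `[a, b]`. -/
theorem exists_abs_sub_bet_le (lam : E →L[ℝ] V) {bet : E →L[ℝ] E →L[ℝ] V}
    (hbet : ∀ x, bet x x = 0) (hH : 0 ≤ H) (hL : 0 ≤ L) :
    ∃ C : ℝ, 0 ≤ C ∧ ∀ α ∈ Icc (0 : ℝ) 1, ∀ (F : E × V → ℝ) (D : E × V → StrongDual ℝ E),
      IsHolderGraph lam bet α H L F D → ∀ a b : E, ‖a‖ ≤ 1 → ‖b‖ ≤ 1 → ∀ ρ, 0 ≤ ρ →
        ∀ c : ℝ, |c| ≤ ρ ^ 2 → ∀ p : E × V,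
          |F (p.1, p.2 + c • bet a b) - F p| ≤ C * growth α ρ := by
  obtain ⟨A, C, hA, hC, hloop⟩ := exists_loop lam hbet hH hL
  have hsA : 1 ≤ √A := Real.one_le_sqrt.2 hA
  refine ⟨C + 2 * √(H * (1 + ‖lam‖)) * A, by positivity, ?_⟩
  have hpos : ∀ α ∈ Icc (0 : ℝ) 1, ∀ (F : E × V → ℝ) (D : E × V → StrongDual ℝ E),
      IsHolderGraph lam bet α H L F D → ∀ a b : E, ‖a‖ ≤ 1 → ‖b‖ ≤ 1 → ∀ ρ, 0 ≤ ρ →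
        ∀ c : ℝ, 0 ≤ c → c ≤ ρ ^ 2 → ∀ p : E × V,
          |F (p.1, p.2 + c • bet a b) - F p| ≤
            (C + 2 * √(H * (1 + ‖lam‖)) * A) * growth α ρ := by
    intro α hα F D h a b ha hb ρ hρ c hc0 hc p
    -- A loop of side `√c` based at `p` reaches the target up to `lam l`, which is then removed by
    -- `abs_sub_lam_le` at scale `√A * ρ`.
    obtain ⟨l, hl, hFl⟩ := hloop α hα _ _ (h.translate p) (by simp [move_zero_right]) a b ha hb
      (√c) (Real.sqrt_nonneg c)
    rw [Real.sq_sqrt hc0] at hl hFl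
    simp only [move_vertical] at hFl
    have hcρ : √c ≤ ρ := Real.sqrt_le_iff.2 ⟨hρ, hc⟩
    have h1 : C * √c ^ (1 + α) ≤ C * growth α ρ :=
      mul_le_mul_of_nonneg_left ((Real.rpow_le_rpow (Real.sqrt_nonneg _) hcρ
        (by linarith [hα.1])).trans (le_max_left _ _)) hC
    have h2 := h.abs_sub_lam_le hbet hα hH (p.1, p.2 + c • bet a b) (y := l) (ρ := √A * ρ)
      (by positivity) (by
        rw [mul_pow, Real.sq_sqrt (by linarith)]
        exact hl.trans (mul_le_mul_of_nonneg_left hc (by linarith)))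
    have h3 := growth_mul_le hα hρ hsA
    rw [Real.sq_sqrt (by linarith)] at h3
    have h4 : 2 * √(H * (1 + ‖lam‖)) * growth α (√A * ρ) ≤
        2 * √(H * (1 + ‖lam‖)) * (A * growth α ρ) := mul_le_mul_of_nonneg_left h3 (by positivity)
    simp only [add_assoc] at h2 hFl
    have k1 := abs_le.1 hFl
    have k2 := abs_le.1 h2
    rw [abs_le]
    constructor <;> linarith [k1.1, k1.2, k2.1, k2.2]
  intro α hα F D h a b ha hb ρ hρ c hc p
  rcases le_total 0 c with hc0 | hc0
  · exact hpos α hα F D h a b ha hb ρ hρ c hc0 (by rwa [abs_of_nonneg hc0] at hc) p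
  · have := hpos α hα F D h (-a) b (by rwa [norm_neg]) hb ρ hρ (-c) (by linarith)
      (by rwa [abs_of_nonpos hc0] at hc) p
    simpa using this

/-- Vertical estimate in all directions, when these are spanned by the brackets. -/
theorem exists_abs_sub_vertical_le [FiniteDimensional ℝ V] (lam : E →L[ℝ] V)
    {bet : E →L[ℝ] E →L[ℝ] V} (hbet : ∀ x, bet x x = 0) (hH : 0 ≤ H) (hL : 0 ≤ L)
    {ι : Type*} [Fintype ι] {a b : ι → E} (ha : ∀ i, ‖a i‖ ≤ 1) (hb : ∀ i, ‖b i‖ ≤ 1)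
    (hspan : ∀ u : V, ∃ (c : ι → ℝ) (y : E), u = ∑ i, c i • bet (a i) (b i) + lam y) :
    ∃ C : ℝ, 0 ≤ C ∧ ∀ α ∈ Icc (0 : ℝ) 1, ∀ (F : E × V → ℝ) (D : E × V → StrongDual ℝ E),
      IsHolderGraph lam bet α H L F D → ∀ ρ, 0 ≤ ρ → ∀ u : V, ‖u‖ ≤ ρ ^ 2 → ∀ p : E × V,
          |F (p.1, p.2 + u) - F p| ≤ C * growth α ρ := by
  obtain ⟨C, hC, hCb⟩ := exists_abs_sub_bet_le lam hbet hH hL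
  let T : ((ι → ℝ) × E) →ₗ[ℝ] V :=
    (∑ i, (LinearMap.proj i).smulRight (bet (a i) (b i))).coprod lam.toLinearMap
  have hT : ∀ c y, T (c, y) = ∑ i, c i • bet (a i) (b i) + lam y := fun c y => by simp [T]
  have hsurj : LinearMap.range T = ⊤ := by
    refine LinearMap.range_eq_top.2 fun u => ?_
    obtain ⟨c, y, h⟩ := hspan u
    exact ⟨(c, y), by rw [hT, h]⟩
  -- A linear right inverse on the finite-dimensional `V` is bounded, so the coefficients of `u` are
  -- O(‖u‖). The brackets are then added one at a time, and the `lam` part last.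
  obtain ⟨R, hR⟩ := T.exists_rightInverse_of_surjective hsurj
  set K : ℝ := 1 + ‖R.toContinuousLinearMap‖ with hK
  have hK1 : 1 ≤ K := by linarith [norm_nonneg R.toContinuousLinearMap]
  have hRb : ∀ u, ‖R u‖ ≤ K * ‖u‖ := fun u =>
    (R.toContinuousLinearMap.le_opNorm u).trans
      (mul_le_mul_of_nonneg_right (by linarith) (norm_nonneg _))
  refine ⟨(Fintype.card ι * C + 2 * √(H * (1 + ‖lam‖))) * K, by positivity, ?_⟩
  intro α hα F D h ρ hρ u hu p
  have hsK : 1 ≤ √K := Real.one_le_sqrt.2 hK1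
  have hRu : ‖R u‖ ≤ (√K * ρ) ^ 2 := by
    rw [mul_pow, Real.sq_sqrt (by linarith)]
    exact (hRb u).trans (mul_le_mul_of_nonneg_left hu (by linarith))
  have hsum : ∀ s : Finset ι, |F (p.1, p.2 + ∑ i ∈ s, (R u).1 i • bet (a i) (b i)) - F p| ≤
      s.card * C * growth α (√K * ρ) := by
    classical
    intro s
    induction s using Finset.induction_on with
    | empty => simp
    | insert i s hi ih =>
      have h1 := hCb α hα F D h (a i) (b i) (ha i) (hb i) (√K * ρ) (by positivity) ((R u).1 i)
        (((norm_le_pi_norm (R u).1 i).trans (norm_fst_le _)).trans hRu)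
        (p.1, p.2 + ∑ i ∈ s, (R u).1 i • bet (a i) (b i))
      rw [Finset.sum_insert hi, Finset.card_insert_of_notMem hi, add_comm ((R u).1 i • _), ← add_assoc]
      simp only at h1
      refine (abs_sub_le _ _ _).trans ((add_le_add h1 ih).trans_eq ?_)
      push_cast
      ring
  have h1 := hsum Finset.univ
  have h2 := h.abs_sub_lam_le hbet hα hH
    (p.1, p.2 + ∑ i, (R u).1 i • bet (a i) (b i)) (y := (R u).2) (ρ := √K * ρ) (by positivity)
    ((norm_snd_le _).trans hRu)
  have hu' : u = ∑ i, (R u).1 i • bet (a i) (b i) + lam (R u).2 := by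
    rw [← hT]
    exact (LinearMap.congr_fun hR u).symm
  simp only [add_assoc] at h2
  rw [← hu'] at h2
  refine (abs_sub_le _ _ _).trans ((add_le_add h2 h1).trans ?_)
  have h3 := growth_mul_le hα hρ hsK
  rw [Real.sq_sqrt (by linarith)] at h3
  rw [← add_mul, add_comm (2 * _), Finset.card_univ, mul_assoc _ K]
  exact mul_le_mul_of_nonneg_left h3 (by positivity)

/-- The first-order expansion of a `C^{1,α}` intrinsic graph, in coordinates. -/
theorem exists_abs_sub_differential_le [FiniteDimensional ℝ V] (lam : E →L[ℝ] V)
    {bet : E →L[ℝ] E →L[ℝ] V} (hbet : ∀ x, bet x x = 0) (hH : 0 ≤ H) (hL : 0 ≤ L)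
    {ι : Type*} [Fintype ι] {a b : ι → E} (ha : ∀ i, ‖a i‖ ≤ 1) (hb : ∀ i, ‖b i‖ ≤ 1)
    (hspan : ∀ u : V, ∃ (c : ι → ℝ) (y : E), u = ∑ i, c i • bet (a i) (b i) + lam y) :
    ∃ C : ℝ, 0 ≤ C ∧ ∀ α ∈ Icc (0 : ℝ) 1, ∀ (F : E × V → ℝ) (D : E × V → StrongDual ℝ E),
      IsHolderGraph lam bet α H L F D → ∀ p q : E × V,
        |F (move lam bet (F p) p q) - F p - D p q.1| ≤ C * growth α (gauge q) := by
  obtain ⟨C, hC, hvert⟩ := exists_abs_sub_vertical_le lam hbet hH hL ha hb hspan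
  set A := nextScale lam bet L 0 with hA
  have hA1 : 0 + 1 + L ≤ A := le_nextScale hL le_rfl
  have hA0 : 0 ≤ A := by linarith
  refine ⟨2 * H * A + C * (1 + A), by positivity, ?_⟩
  intro α hα F D h p q
  have h' := h.translate p
  have hF0 : F (move lam bet (F p) p 0) - F p = 0 := by simp [move_zero_right]
  set r := gauge q with hr
  have hr0 : 0 ≤ r := gauge_nonneg q
  have hq1 : ‖q.1‖ ≤ r := le_add_of_nonneg_right (Real.sqrt_nonneg _)
  have hq2 : ‖q.2‖ ≤ r ^ 2 :=
    (Real.sqrt_le_left hr0).1 (le_add_of_nonneg_left (norm_nonneg _))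
  -- For `r = 0` the identity survives because then `q.1 = 0`.
  have hre : r • (r⁻¹ • q.1) = q.1 := by
    rcases eq_or_ne r 0 with h0 | h0
    · rw [h0] at hq1
      simp [norm_le_zero_iff.1 hq1]
    · exact smul_inv_smul₀ h0 _
  have he : ‖r⁻¹ • q.1‖ ≤ 1 := by
    rw [norm_smul, norm_inv, Real.norm_eq_abs, abs_of_nonneg hr0]
    exact inv_mul_le_one_of_le₀ hq1 hr0
  obtain ⟨z, -, hz, hest⟩ := h'.exists_segment hbet hα hH hF0 le_rfl hr0 (p := 0)
    (by simp [AtScale, move_zero_right]) he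
  have hDr : r * D p (r⁻¹ • q.1) = D p q.1 := by rw [← smul_eq_mul, ← map_smul, hre]
  rw [hre] at hest hz
  simp only [Prod.fst_zero, Prod.snd_zero, zero_add, map_zero, zero_apply, smul_zero, add_zero,
    move_zero_right, sub_self, sub_zero, hDr] at hest hz
  set w : V := z • lam (r⁻¹ • q.1) with hw
  have hz2 : ‖w‖ ≤ A * r ^ 2 := hz.2.1
  have hsA : 1 ≤ √(1 + A) := Real.one_le_sqrt.2 (by linarith)
  -- The curve ends at `(q.1, w)`. The remaining displacement to `q` is vertical, of norm at most
  -- `(1 + A) * r ^ 2`.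
  have hv := hvert α hα _ _ h' (√(1 + A) * r) (by positivity) (q.2 - w) (by
    rw [mul_pow, Real.sq_sqrt (by linarith)]
    linarith [norm_sub_le q.2 w]) (q.1, w)
  simp only [add_sub_cancel, Prod.mk.eta] at hv
  have h3 := growth_mul_le hα hr0 hsA
  rw [Real.sq_sqrt (by linarith)] at h3
  have h4 := mul_le_mul_of_nonneg_left h3 hC
  have h5 : 2 * H * A * r ^ (1 + α) ≤ 2 * H * A * growth α r :=
    mul_le_mul_of_nonneg_left (le_max_left _ _) (by positivity)
  have k1 := abs_le.1 hest
  have k2 := abs_le.1 hv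
  rw [abs_le]
  constructor <;> linarith [k1.1, k1.2, k2.1, k2.2]

end Horizontal

/-! ### Coordinates on the vertical subgroup and transfer from the group -/

section Chart

universe u

variable {𝔤 : Type u} [LieRing 𝔤] [LieAlgebra ℝ 𝔤] {S : Stratification 𝔤}

theorem Stratification.horiz_coe_add (a : S.V₁) (b : S.V₂) : S.horiz ((a : 𝔤) + b) = a := by
  rw [map_add, Stratification.horiz, Submodule.projectionOnto_apply_left,
    Submodule.projectionOnto_apply_right, add_zero]

theorem Stratification.vert_coe_add (a : S.V₁) (b : S.V₂) : S.vert ((a : 𝔤) + b) = b := by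
  rw [map_add, Stratification.vert, Submodule.projectionOnto_apply_left,
    Submodule.projectionOnto_apply_right, zero_add]

variable (S) in
/-- The bracket, with values in the second layer. -/
def Stratification.bracket : 𝔤 →ₗ[ℝ] 𝔤 →ₗ[ℝ] S.V₂ :=
  LinearMap.mk₂ ℝ (fun U V => ⟨⁅U, V⁆, S.lie_mem U V⟩) (fun _ _ _ => Subtype.ext (add_lie _ _ _))
    (fun _ _ _ => Subtype.ext (smul_lie _ _ _)) (fun _ _ _ => Subtype.ext (lie_add _ _ _))
    (fun _ _ _ => Subtype.ext (lie_smul _ _ _))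

theorem Stratification.coe_bracket (U V : 𝔤) : (S.bracket U V : 𝔤) = ⁅U, V⁆ := rfl

variable {n : ℕ} (X : Module.Basis (Fin (n + 1)) ℝ S.V₁)

/-- The horizontal vector with coordinates `(0, y_1, …, y_n)`. -/
def horVec : EuclideanSpace ℝ (Fin n) →ₗ[ℝ] S.V₁ where
  toFun y := ∑ i, y i • X i.succ
  map_add' x y := by simp [add_smul, Finset.sum_add_distrib]
  map_smul' c y := by simp [Finset.smul_sum, smul_smul]

theorem horVec_apply (y : EuclideanSpace ℝ (Fin n)) : horVec X y = ∑ i, y i • X i.succ := rfl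

theorem horVec_single (i : Fin n) : horVec X (EuclideanSpace.single i 1) = X i.succ := by
  simp [horVec_apply]

theorem repr_horVec_zero (y : EuclideanSpace ℝ (Fin n)) : X.repr (horVec X y) 0 = 0 := by
  simp [horVec_apply, Fin.succ_ne_zero]

theorem repr_horVec_succ (y : EuclideanSpace ℝ (Fin n)) (i : Fin n) :
    X.repr (horVec X y) i.succ = y i := by
  simp [horVec_apply, Finsupp.single_apply]

theorem eq_smul_add_horVec (x : S.V₁) :
    x = X.repr x 0 • X 0 + horVec X (WithLp.toLp 2 fun i => X.repr x i.succ) := by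
  conv_lhs => rw [← X.sum_repr x, Fin.sum_univ_succ]
  rfl

variable {V : Type*} [NormedAddCommGroup V] [NormedSpace ℝ V] (j : V ≃ₗ[ℝ] S.V₂)

/-- Coordinates on the vertical subgroup. -/
def chart (q : EuclideanSpace ℝ (Fin n) × V) : W X :=
  ⟨⟨(horVec X q.1 : 𝔤) + (j q.2 : 𝔤)⟩, by
    change X.repr (S.horiz _) 0 = 0
    rw [S.horiz_coe_add, repr_horVec_zero]⟩

theorem log_chart (q : EuclideanSpace ℝ (Fin n) × V) :
    (chart X j q : CarnotGroup S).log = (horVec X q.1 : 𝔤) + (j q.2 : 𝔤) := rfl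

theorem hor_chart (q : EuclideanSpace ℝ (Fin n) × V) : hor X (chart X j q) = q.1 := by
  ext i
  simp [hor, coord, log_chart, S.horiz_coe_add, repr_horVec_succ, -map_add]

theorem chart_zero : chart X j 0 = 1 := by
  ext
  simp [log_chart, log_one]

theorem chart_surjective : Function.Surjective (chart X j) := by
  intro w
  refine ⟨(hor X w, j.symm (S.vert (w : CarnotGroup S).log)), ?_⟩
  ext
  rw [log_chart, LinearEquiv.apply_symm_apply]
  have h0 : X.repr (S.horiz (w : CarnotGroup S).log) 0 = 0 := w.2
  have h1 := eq_smul_add_horVec X (S.horiz (w : CarnotGroup S).log)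
  rw [h0, zero_smul, zero_add] at h1
  have h2 : horVec X (hor X w) = S.horiz (w : CarnotGroup S).log := h1.symm
  rw [h2, S.horiz_add_vert]

theorem chart_dil (t : ℝ) (q : EuclideanSpace ℝ (Fin n) × V) :
    (chart X j (t • q.1, t ^ 2 • q.2) : CarnotGroup S) = dil t (chart X j q : CarnotGroup S) := by
  ext
  simp only [log_chart, dil, S.horiz_coe_add, S.vert_coe_add, map_smul, Submodule.coe_smul]

/-- The map `y ↦ [X 0, y]` in coordinates. -/
def lieDir : EuclideanSpace ℝ (Fin n) →L[ℝ] V :=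
  LinearMap.toContinuousLinearMap
    (j.symm.toLinearMap ∘ₗ S.bracket (X 0 : 𝔤) ∘ₗ S.V₁.subtype ∘ₗ horVec X)

/-- The bracket of the horizontal directions of `𝕎` in coordinates. -/
def lieHor : EuclideanSpace ℝ (Fin n) →L[ℝ] EuclideanSpace ℝ (Fin n) →L[ℝ] V :=
  LinearMap.toContinuousBilinearMap
    ((S.bracket.compl₁₂ (S.V₁.subtype ∘ₗ horVec X) (S.V₁.subtype ∘ₗ horVec X)).compr₂
      j.symm.toLinearMap)

theorem apply_lieDir (y : EuclideanSpace ℝ (Fin n)) :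
    j (lieDir X j y) = S.bracket (X 0 : 𝔤) (horVec X y : 𝔤) := by
  simp [lieDir]

theorem apply_lieHor (x y : EuclideanSpace ℝ (Fin n)) :
    j (lieHor X j x y) = S.bracket (horVec X x : 𝔤) (horVec X y : 𝔤) := by
  simp [lieHor]

theorem lieHor_self (x : EuclideanSpace ℝ (Fin n)) : lieHor X j x x = 0 := by
  apply j.injective
  rw [apply_lieHor, map_zero]
  exact Subtype.ext (lie_self _)

/-- Splitting off the `X 0` components, [aX₀ + x', bX₀ + y'] = [x', y'] + [X₀, ay' - bx'], and such
brackets span the second layer. -/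
theorem exists_eq_sum_lieHor_add_lieDir (u : V) :
    ∃ (c : Fin n × Fin n → ℝ) (y : EuclideanSpace ℝ (Fin n)),
      u = ∑ i, c i • lieHor X j (EuclideanSpace.single i.1 1) (EuclideanSpace.single i.2 1) +
        lieDir X j y := by
  suffices hz : ∀ z ∈ Submodule.span ℝ {z : 𝔤 | ∃ x ∈ S.V₁, ∃ y ∈ S.V₁, ⁅x, y⁆ = z},
      ∃ (c : Fin n × Fin n → ℝ) (y : EuclideanSpace ℝ (Fin n)),
        z = ∑ i, c i • ⁅(X i.1.succ : 𝔤), (X i.2.succ : 𝔤)⁆ + ⁅(X 0 : 𝔤), (horVec X y : 𝔤)⁆ by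
    obtain ⟨c, y, h⟩ := hz (j u) (by rw [S.span_lie]; exact (j u).2)
    refine ⟨c, y, j.injective (Subtype.ext ?_)⟩
    rw [h, map_add, map_sum, apply_lieDir]
    simp [apply_lieHor, horVec_single, S.coe_bracket]
  intro z hz
  induction hz using Submodule.span_induction with
  | mem z hz =>
    obtain ⟨x, hx, y, hy, rfl⟩ := hz
    have ex := congrArg (Subtype.val) (eq_smul_add_horVec X ⟨x, hx⟩)
    have ey := congrArg (Subtype.val) (eq_smul_add_horVec X ⟨y, hy⟩)
    set a := X.repr ⟨x, hx⟩ 0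
    set b := X.repr ⟨y, hy⟩ 0
    set x' : EuclideanSpace ℝ (Fin n) := WithLp.toLp 2 fun i => X.repr ⟨x, hx⟩ i.succ
    set y' : EuclideanSpace ℝ (Fin n) := WithLp.toLp 2 fun i => X.repr ⟨y, hy⟩ i.succ
    simp only [Submodule.coe_add, Submodule.coe_smul] at ex ey
    have hxy : ⁅(horVec X x' : 𝔤), (horVec X y' : 𝔤)⁆ =
        ∑ i : Fin n × Fin n, (x' i.1 * y' i.2) • ⁅(X i.1.succ : 𝔤), (X i.2.succ : 𝔤)⁆ := by
      simp only [horVec_apply, Submodule.coe_sum, Submodule.coe_smul, sum_lie_sum, smul_lie,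
        lie_smul, smul_smul, Fintype.sum_prod_type, mul_comm (y' _)]
    refine ⟨fun i => x' i.1 * y' i.2, a • y' - b • x', ?_⟩
    rw [ex, ey, ← hxy]
    simp only [add_lie, lie_add, smul_lie, lie_smul, lie_self, smul_zero, map_sub, map_smul,
      Submodule.coe_sub, Submodule.coe_smul, lie_sub, zero_add]
    rw [← lie_skew (X 0 : 𝔤) (horVec X x' : 𝔤)]
    module
  | zero => exact ⟨0, 0, by simp⟩
  | add z w _ _ hz hw =>
    obtain ⟨c, y, rfl⟩ := hz
    obtain ⟨d, x, rfl⟩ := hw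
    refine ⟨c + d, y + x, ?_⟩
    simp only [Pi.add_apply, add_smul, Finset.sum_add_distrib, map_add, Submodule.coe_add, lie_add]
    abel
  | smul r z _ hz =>
    obtain ⟨c, y, rfl⟩ := hz
    refine ⟨r • c, r • y, ?_⟩
    simp [Finset.smul_sum, smul_smul]

theorem dil_dir (c : ℝ) : (dil c (dir X)).log = c • (X 0 : 𝔤) := by
  have h1 := S.horiz_coe_add (X 0) 0
  have h2 := S.vert_coe_add (X 0) 0
  rw [Submodule.coe_zero, add_zero] at h1 h2
  simp [dil, dir, h1, h2]

theorem coord_zero_graph_mul (φ : W X → ℝ) (w₀ w : W X) :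
    coord X 0 (graph X φ w₀ * (w : CarnotGroup S)) = φ w₀ := by
  have h0 : coord X 0 (w₀ : CarnotGroup S) = 0 := w₀.2
  have h1 : coord X 0 (w : CarnotGroup S) = 0 := w.2
  rw [graph, coord_mul, coord_mul, h0, h1, coord_zero_dil_dir, zero_add, add_zero]

theorem coe_projW_graph_mul (φ : W X → ℝ) (w₀ w : W X) :
    (projW X (graph X φ w₀ * (w : CarnotGroup S)) : CarnotGroup S) =
      graph X φ w₀ * (w : CarnotGroup S) * (dil (φ w₀) (dir X))⁻¹ := by
  rw [← coord_zero_graph_mul X φ w₀ w]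
  rfl

theorem inv_dil_dir (c : ℝ) : (dil c (dir X))⁻¹ = dil (-c) (dir X) := by
  ext
  simp [log_inv, dil_dir]

/-- The origin of `move`: in step two, conjugating `q` by vᶜ only adds c[X 0, q] to its second
layer. -/
theorem projW_graph_mul_chart (φ : W X → ℝ) (p q : EuclideanSpace ℝ (Fin n) × V) :
    projW X (graph X φ (chart X j p) * (chart X j q : CarnotGroup S)) =
      chart X j (move (lieDir X j) (lieHor X j) (φ (chart X j p)) p q) := by
  set c := φ (chart X j p) with hc
  have hV : ∀ (U : 𝔤) (v : V), ⁅U, (j v : 𝔤)⁆ = 0 := fun U v => S.lie_V₂ U _ (j v).2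
  have hV' : ∀ (U : 𝔤) (v : V), ⁅(j v : 𝔤), U⁆ = 0 := fun U v => by
    rw [← lie_skew, hV, neg_zero]
  ext
  rw [coe_projW_graph_mul, ← hc, log_chart]
  simp only [graph, log_mul, log_inv, dil_dir, log_chart, ← hc, move, map_add, map_smul,
    apply_lieDir, apply_lieHor, Submodule.coe_add, Submodule.coe_smul, S.coe_bracket, add_lie,
    lie_add, smul_lie, lie_smul, lie_neg, hV, hV', S.lie_lie_left, lie_self,
    smul_zero, add_zero]
  rw [← lie_skew (X 0 : 𝔤) (horVec X q.1 : 𝔤)]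
  module

theorem translate_graph_inv (φ : W X → ℝ) (w₀ w : W X) :
    translate X φ (graph X φ w₀)⁻¹ w =
      φ (projW X (graph X φ w₀ * (w : CarnotGroup S))) - φ w₀ := by
  rw [translate, inv_inv, coord_zero_graph_mul]

theorem translate_translate (φ : W X → ℝ) (a b : CarnotGroup S) :
    translate X (translate X φ a) b = translate X φ (b * a) := by
  refine translate_unique φ _ (b * a) ?_
  rw [range_graph_translate, range_graph_translate, image_image]
  simp only [mul_assoc]

theorem graph_translate_graph_inv (φ : W X → ℝ) (w₀ w : W X) :
    graph X φ w₀ * graph X (translate X φ (graph X φ w₀)⁻¹) w =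
      graph X φ (projW X (graph X φ w₀ * (w : CarnotGroup S))) := by
  rw [graph.eq_1 X (translate X φ (graph X φ w₀)⁻¹), translate_graph_inv, sub_eq_neg_add,
    dil_add_dir, ← inv_dil_dir, graph.eq_1 X φ (projW X _), coe_projW_graph_mul]
  simp only [mul_assoc]

variable {X j} in
theorem eq_zero_of_chart_eq_one {q : EuclideanSpace ℝ (Fin n) × V} (h : chart X j q = 1) :
    q = 0 := by
  have h1 := congrArg (fun w : W X => (w : CarnotGroup S).log) h
  simp only [log_chart, Subgroup.coe_one, log_one] at h1
  have h2 := S.horiz_coe_add (horVec X q.1) (j q.2)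
  have h3 := S.vert_coe_add (horVec X q.1) (j q.2)
  rw [h1, map_zero] at h2 h3
  ext i
  · rw [← repr_horVec_succ X, ← h2]
    simp
  · exact (LinearEquiv.map_eq_zero_iff j).1 h3.symm

variable [TopologicalSpace 𝔤]

/-- Both sides are the differential at the identity of one and the same translate of `φ`. The Hölder
condition on all translates thus becomes a condition on the single field `intrinsicDiff N φ`. -/
theorem intrinsicDiff_translate (N : CarnotGroup S → ℝ) (φ : W X → ℝ) (w₀ w : W X) :
    intrinsicDiff N (translate X φ (graph X φ w₀)⁻¹) w =
      intrinsicDiff N φ (projW X (graph X φ w₀ * (w : CarnotGroup S))) := by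
  rw [intrinsicDiff, intrinsicDiff, translate_translate, ← mul_inv_rev, graph_translate_graph_inv]

variable {X} in
theorem hasIntrinsicDiffZero_intrinsicDiff {N : CarnotGroup S → ℝ} {φ : W X → ℝ} {w : W X}
    (h : IntrinsicDifferentiableAt N φ w) :
    HasIntrinsicDiffZero N (translate X φ (graph X φ w)⁻¹) (intrinsicDiff N φ w) := by
  have h' : ∃ T, HasIntrinsicDiffZero N (translate X φ (graph X φ w)⁻¹) T := h
  rw [intrinsicDiff, intrinsicDiffZero, dif_pos h']
  exact h'.choose_spec

variable [IsTopologicalAddGroup 𝔤] [ContinuousSMul ℝ 𝔤]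

theorem continuous_chart [FiniteDimensional ℝ V] : Continuous (chart X j) := by
  refine Continuous.subtype_mk (continuous_induced_rng.2 ?_) _
  let T : EuclideanSpace ℝ (Fin n) × V →ₗ[ℝ] 𝔤 :=
    (S.V₁.subtype ∘ₗ horVec X).coprod (S.V₂.subtype ∘ₗ j.toLinearMap)
  exact T.continuous_of_finiteDimensional

/-- Every homogeneous norm is comparable with the gauge. -/
theorem exists_norm_chart_le_gauge [FiniteDimensional ℝ V] {N : CarnotGroup S → ℝ} (hN : IsHomogeneousNorm N) :
    ∃ K : ℝ, 1 ≤ K ∧ ∀ q, N (chart X j q : CarnotGroup S) ≤ K * gauge q ∧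
      gauge q ≤ K * N (chart X j q : CarnotGroup S) := by
  set f : EuclideanSpace ℝ (Fin n) × V → ℝ := fun q => N (chart X j q : CarnotGroup S) with hf
  have hfc : Continuous f := hN.continuous.comp (continuous_subtype_val.comp (continuous_chart X j))
  have hgc : Continuous (gauge : EuclideanSpace ℝ (Fin n) × V → ℝ) := by
    unfold gauge
    fun_prop
  have hgauge : ∀ q : EuclideanSpace ℝ (Fin n) × V, gauge q = 1 → ‖q‖ ≤ 1 := by
    intro q hq
    have h1 : 0 ≤ ‖q.1‖ := norm_nonneg _
    have h2 : 0 ≤ √‖q.2‖ := Real.sqrt_nonneg _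
    rw [gauge] at hq
    exact max_le (by linarith) (Real.sqrt_le_one.1 (by linarith))
  -- The norm and its inverse are bounded on the compact gauge sphere; dilations extend the
  -- comparison to all points, without any triangle inequality.
  have hcomp : IsCompact {q : EuclideanSpace ℝ (Fin n) × V | gauge q = 1} :=
    (isCompact_closedBall (0 : EuclideanSpace ℝ (Fin n) × V) 1).of_isClosed_subset
      (isClosed_eq hgc continuous_const) fun q hq => by simpa using hgauge q hq
  have hpos : ∀ q, gauge q = 1 → 0 < f q := by
    intro q hq
    refine lt_of_le_of_ne (hN.nonneg _) fun h => ?_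
    have := eq_zero_of_chart_eq_one (Subtype.ext ((hN.eq_zero_iff _).1 h.symm) : chart X j q = 1)
    rw [this, gauge_zero] at hq
    exact zero_ne_one hq
  obtain ⟨A, hA⟩ := hcomp.exists_bound_of_continuousOn hfc.continuousOn
  obtain ⟨B, hB⟩ := hcomp.exists_bound_of_continuousOn (f := fun q => (f q)⁻¹)
    (hfc.continuousOn.inv₀ fun q hq => (hpos q hq).ne')
  refine ⟨max 1 (max A B), le_max_left _ _, fun q => ?_⟩
  rcases (gauge_nonneg q).eq_or_lt with h0 | h0
  · have h1 : ‖q.1‖ = 0 := by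
      have := norm_nonneg q.1
      have := Real.sqrt_nonneg ‖q.2‖
      rw [gauge] at h0
      linarith
    have h2 : √‖q.2‖ = 0 := by
      rw [gauge] at h0
      linarith
    rw [Real.sqrt_eq_zero (norm_nonneg _)] at h2
    have hq : q = 0 := Prod.ext (norm_eq_zero.1 h1) (norm_eq_zero.1 h2)
    have hN1 : N 1 = 0 := (hN.eq_zero_iff 1).2 rfl
    simp [hq, chart_zero, gauge_zero, hN1]
  · set ρ := gauge q with hρ
    set q' : EuclideanSpace ℝ (Fin n) × V := (ρ⁻¹ • q.1, ρ⁻¹ ^ 2 • q.2) with hq'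
    have hq'1 : gauge q' = 1 := by
      rw [hq', gauge]
      simp only [norm_smul, norm_pow, norm_inv, Real.norm_eq_abs, abs_of_pos h0]
      rw [Real.sqrt_mul (by positivity), Real.sqrt_sq (by positivity), ← mul_add]
      exact inv_mul_cancel₀ h0.ne'
    have hfq : f q' = ρ⁻¹ * f q := by
      simp only [hf]
      rw [hq', chart_dil, hN.dil _ (inv_pos.2 h0)]
    have h1 := hA q' hq'1
    have h2 := hB q' hq'1
    have hp := hpos q' hq'1
    rw [Real.norm_eq_abs, abs_of_pos hp, hfq, inv_mul_le_iff₀ h0] at h1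
    rw [Real.norm_eq_abs, abs_of_pos (inv_pos.2 hp), inv_le_iff_one_le_mul₀ hp, hfq,
      ← mul_assoc, mul_comm B, mul_assoc, ← div_eq_inv_mul, one_le_div h0] at h2
    have hfq0 : 0 ≤ f q := hN.nonneg _
    constructor
    · rw [mul_comm]
      exact h1.trans (mul_le_mul_of_nonneg_left ((le_max_left _ _).trans (le_max_right _ _)) h0.le)
    · exact h2.trans (mul_le_mul_of_nonneg_right ((le_max_right _ _).trans (le_max_right _ _)) hfq0)

/-- A function with an intrinsic differential everywhere is continuous. -/
theorem continuous_of_intrinsic_diff {E : Type*} [NormedAddCommGroup E] [NormedSpace ℝ E]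
    {lam : E →L[ℝ] V} {bet : E →L[ℝ] E →L[ℝ] V} {F : E × V → ℝ} {D : E × V → StrongDual ℝ E}
    (h : ∀ p, ∀ ε > 0, ∀ᶠ q in 𝓝 (0 : E × V),
      |F (move lam bet (F p) p q) - F p - D p q.1| ≤ ε * gauge q) : Continuous F := by
  refine continuous_iff_continuousAt.2 fun p => ?_
  -- A continuous right inverse of `move lam bet (F p) p`, sending `p` to the origin; it turns the
  -- intrinsic expansion at `p` into ordinary continuity there.
  set σ : E × V → E × V := fun r => (r.1 - p.1,
    r.2 - p.2 - F p • lam (r.1 - p.1) - (1 / 2 : ℝ) • bet p.1 (r.1 - p.1)) with hσ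
  have hσc : Continuous σ := by
    rw [hσ]
    fun_prop
  have hσp : σ p = 0 := by simp [hσ]
  have hσm : ∀ r, move lam bet (F p) p (σ r) = r := by
    intro r
    ext
    · simp [move, hσ]
    · simp only [move, hσ]
      abel
  have ht : Tendsto σ (𝓝 p) (𝓝 0) := hσp ▸ hσc.tendsto p
  have hgc : Continuous (gauge : E × V → ℝ) := by
    unfold gauge
    fun_prop
  have hlim : Tendsto (fun r => gauge (σ r) + |D p (σ r).1|) (𝓝 p) (𝓝 0) := by
    have hc : Continuous fun r => gauge (σ r) + |D p (σ r).1| := by fun_prop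
    have := hc.tendsto p
    rwa [hσp, gauge_zero, Prod.fst_zero, map_zero, abs_zero, add_zero] at this
  refine tendsto_iff_dist_tendsto_zero.2 (squeeze_zero' (Eventually.of_forall fun _ => dist_nonneg)
    ?_ hlim)
  filter_upwards [ht.eventually (h p 1 one_pos)] with r hr
  rw [hσm, one_mul] at hr
  rw [Real.dist_eq]
  have := abs_add_le (F r - F p - D p (σ r).1) (D p (σ r).1)
  rw [sub_add_cancel] at this
  linarith

variable {X} in
-- Passing from the norm to the gauge costs a factor K^α ≤ K in the Hölder constant. Continuity of
-- `φ` is not assumed; it follows from intrinsic differentiability.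
theorem IsIntrinsicC1Alpha.isHolderGraph [FiniteDimensional ℝ V] {N : CarnotGroup S → ℝ} {α H L K : ℝ} {φ : W X → ℝ}
    (hN : IsHomogeneousNorm N) (hα : α ∈ Icc (0 : ℝ) 1) (hH : 0 ≤ H) (hK1 : 1 ≤ K)
    (hK : ∀ q, N (chart X j q : CarnotGroup S) ≤ K * gauge q)
    (h : IsIntrinsicC1Alpha N α H φ) (hL : ∀ w, ‖intrinsicGrad N φ w‖ ≤ L) :
    IsHolderGraph (lieDir X j) (lieHor X j) α (H * K) L (fun q => φ (chart X j q))
      (fun q => intrinsicDiff N φ (chart X j q)) := by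
  have hdiff : ∀ p, ∀ ε > 0, ∀ᶠ q in 𝓝 (0 : EuclideanSpace ℝ (Fin n) × V),
      |φ (chart X j (move (lieDir X j) (lieHor X j) (φ (chart X j p)) p q)) - φ (chart X j p) -
        intrinsicDiff N φ (chart X j p) q.1| ≤ ε * gauge q := by
    intro p ε hε
    have hd := hasIntrinsicDiffZero_intrinsicDiff (h.isC1.differentiable (chart X j p))
    have hev := eventually_nhdsWithin_iff.1
      (hd.2.eventually (gt_mem_nhds (show 0 < ε / K by positivity)))
    have ht : Tendsto (chart X j) (𝓝 0) (𝓝 1) := by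
      simpa only [chart_zero] using (continuous_chart X j).tendsto 0
    filter_upwards [ht.eventually hev] with q hq
    rcases eq_or_ne (chart X j q) 1 with h1 | h1
    · simp [eq_zero_of_chart_eq_one h1, move_zero_right, gauge_zero]
    · have hNpos : 0 < N (chart X j q : CarnotGroup S) :=
        lt_of_le_of_ne (hN.nonneg _) fun h0 =>
          h1 (Subtype.ext ((hN.eq_zero_iff _).1 h0.symm))
      have hq' := hq h1
      rw [div_lt_iff₀ hNpos, translate_graph_inv, projW_graph_mul_chart, hor_chart] at hq'
      refine hq'.le.trans ?_
      rw [div_mul_eq_mul_div, div_le_iff₀ (by linarith), mul_assoc, mul_comm _ K]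
      exact mul_le_mul_of_nonneg_left (hK q) hε.le
  refine ⟨continuous_of_intrinsic_diff hdiff, hdiff, fun p q => ?_, fun p => ?_⟩
  · have h1 := h.holder _ ⟨chart X j p, rfl⟩ (chart X j q)
    rw [intrinsicDiff_translate, intrinsicDiff_translate, projW_graph_mul_chart,
      ← chart_zero X j, projW_graph_mul_chart, move_zero_right] at h1
    refine h1.trans ?_
    rw [mul_assoc]
    refine mul_le_mul_of_nonneg_left ?_ hH
    exact (Real.rpow_le_rpow (hN.nonneg _) (hK q) hα.1).trans
      (mul_rpow_le hα (gauge_nonneg q) hK1)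
  · have := hL (chart X j p)
    rwa [intrinsicGrad, LinearIsometryEquiv.norm_map] at this

end Chart

end

end Step2Carnot

theorem proposition3p2 {𝔤 : Type*} [LieRing 𝔤] [LieAlgebra ℝ 𝔤] [FiniteDimensional ℝ 𝔤]
    [TopologicalSpace 𝔤] [IsTopologicalAddGroup 𝔤] [ContinuousSMul ℝ 𝔤] [T2Space 𝔤]
    (S : Step2Carnot.Stratification 𝔤) {n : ℕ} (X : Module.Basis (Fin (n + 1)) ℝ S.V₁)
    (N : Step2Carnot.CarnotGroup S → ℝ) (hN : Step2Carnot.IsHomogeneousNorm N)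
    (L H : ℝ) (hL : 0 ≤ L) (hH : 0 < H) :
    ∃ C : ℝ, 0 < C ∧ ∀ α ∈ Set.Icc (0 : ℝ) 1, ∀ φ : Step2Carnot.W X → ℝ,
      Step2Carnot.IsIntrinsicC1Alpha N α H φ →
      (∀ w, ‖Step2Carnot.intrinsicGrad N φ w‖ ≤ L) →
      ∀ w₀ w : Step2Carnot.W X,
        |Step2Carnot.translate X φ (Step2Carnot.graph X φ w₀)⁻¹ w -
            inner ℝ (Step2Carnot.intrinsicGrad N φ w₀) (Step2Carnot.hor X w)| ≤
          C * max (N (w : Step2Carnot.CarnotGroup S) ^ (1 + α))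
            (N (w : Step2Carnot.CarnotGroup S) ^ (1 + α / 2)) := by
  -- The Lie algebra carries only a topology; this identification supplies a norm for the second
  -- layer.
  let j : EuclideanSpace ℝ (Fin (Module.finrank ℝ S.V₂)) ≃ₗ[ℝ] S.V₂ :=
    LinearEquiv.ofFinrankEq _ _ (by simp)
  obtain ⟨K, hK1, hK⟩ := Step2Carnot.exists_norm_chart_le_gauge X j hN
  obtain ⟨C, hC, hmain⟩ := Step2Carnot.exists_abs_sub_differential_le (H := H * K) (L := L)
    (Step2Carnot.lieDir X j) (Step2Carnot.lieHor_self X j) (by positivity) hL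
    (a := fun i : Fin n × Fin n => EuclideanSpace.single i.1 1)
    (b := fun i : Fin n × Fin n => EuclideanSpace.single i.2 1) (by simp) (by simp)
    (Step2Carnot.exists_eq_sum_lieHor_add_lieDir X j)
  -- `K ^ 2` is the cost of returning from the gauge to `N` inside `growth`; the summand 1 makes the
  -- constant positive.
  refine ⟨C * K ^ 2 + 1, by positivity, ?_⟩
  intro α hα φ hφ hgrad w₀ w
  obtain ⟨p, rfl⟩ := Step2Carnot.chart_surjective X j w₀
  obtain ⟨q, rfl⟩ := Step2Carnot.chart_surjective X j w
  have h1 := hmain α hα _ _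
    (hφ.isHolderGraph j hN hα hH.le hK1 (fun q => (hK q).1) hgrad) p q
  rw [Step2Carnot.translate_graph_inv, Step2Carnot.projW_graph_mul_chart, Step2Carnot.hor_chart,
    Step2Carnot.intrinsicGrad, InnerProductSpace.toDual_symm_apply]
  have h2 := (Step2Carnot.growth_mono hα.1 (Step2Carnot.gauge_nonneg q) (hK q).2).trans
    (Step2Carnot.growth_mul_le hα (hN.nonneg _) hK1)
  have h3 := Step2Carnot.growth_nonneg α (hN.nonneg (Step2Carnot.chart X j q))
  have h4 := mul_le_mul_of_nonneg_left h2 hC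
  change _ ≤ (C * K ^ 2 + 1) *
    Step2Carnot.growth α (N (Step2Carnot.chart X j q : Step2Carnot.CarnotGroup S))
  refine h1.trans (h4.trans ?_)
  linarith
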